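/- All manifolds are smooth, finite-dimensional, without boundary, Hausdorff and second countable; all functions, forms and vector fields are smooth. A $k$-polycosymplectic structure on a manifold $M$ consists of closed $2$-forms $\omega^1,\dots,\omega^k$ and closed $1$-forms $\eta^1,\dots,\eta^k$ such that, at every point, $\eta^1\wedge\dots\wedge\eta^k\neq 0$, $\bigcap_a\ker\omega^a\cap\bigcap_a\ker\eta^a=\{0\}$ and $\dim\bigcap_a\ker\omega^a=k$. Its Reeb vector fields $R_1,\dots,R_k$ are determined by $i_{R_a}\omega^b=0$, $i_{R_a}\eta^b=\delta_a^b$, and $\mathcal R=\mathrm{span}\{R_1,\dots,R_k\}$. A $k$-vector field $\mathbf X=(X_1,\dots,X_k)$ solves the $k$-cosymplectic Hamilton equations for $H\colon M\to\mathbb R$ if $$\eta^a(X_b)=\delta^a_b,\qquad \sum_{a=1}^k i_{X_a}\omega^a=dH-\sum_{a=1}^k R_a(H)\,\eta^a .$$ For a subspace $V\subset T_xM$ put $V^{c\omega}=\{v\in T_xM : \omega^a_x(v,s)=0 \text{ for all } s\in V \text{ and all } a\}$. Theorem. Let $(M,\omega^a,\eta^a)$ be a $k$-polycosymplectic manifold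 and let $G$ be a connected Lie group with Lie algebra $\mathfrak g$, acting on $M$ from the left, smoothly, freely and properly, by maps $\Phi_g$. Write $\xi_M$ for the infinitesimal generator of $\xi\in\mathfrak g$, and suppose that the action is polycosymplectic: $\Phi_g^*\omega^a=\omega^a$ and $i_{\xi_M}\eta^a=0$ for all $g\in G$, $\xi\in\mathfrak g$ and $a$. Let $J=(J^1,\dots,J^k)\colon M\to(\mathfrak g^*)^k$ be an equivariant momentum map, that is, $i_{\xi_M}\omega^a=d\langle J^a,\xi\rangle$ and $J^a(\Phi_g(x))=\mathrm{Ad}^*_{g^{-1}}J^a(x)$, and let $\mu=(\mu_1,\dots,\mu_k)$ be a regular value of $J$. Let $G_\mu=\{g\in G:\mathrm{Ad}^*_{g^{-1}}\mu_a=\mu_a \text{ for all } a\}$, with Lie algebra $\mathfrak g_\mu$, and put $\tilde{\mathfrak g}_x=\{\xi_M(x):\xi\in\mathfrak g\}$ and $\tilde{\mathfrak g}_\mu|_x=\{\xi_M(x):\xi\in\mathfrak g_\mu\}$. Regard $J^{-1}(\mu)$ as an embedded submanifold of $M$ with inclusion $j_\mu$, and let $M_\mu=J^{-1}(\mu)/G_\mu$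 be the orbit space with its quotient manifold structure, i.e. the one for which the projection $\pi_\mu\colon J^{-1}(\mu)\to M_\mu$ is a submersion. Suppose that for every $x\in J^{-1}(\mu)$ $$\mathcal R_x\oplus\tilde{\mathfrak g}_\mu|_x=\tilde{\mathfrak g}_x^{c\omega}\cap\tilde{\mathfrak g}_x^{c\omega\,c\omega}.$$ Let $H\colon M\to\mathbb R$ be $G$-invariant, and let $\mathbf X$ be a $k$-vector field on $M$ which solves the $k$-cosymplectic Hamilton equations for $H$, whose components are tangent to $J^{-1}(\mu)$ (at the points of $J^{-1}(\mu)$), and which is $G_\mu$-invariant ($T\Phi_g\circ X_a=X_a\circ\Phi_g$ for $g\in G_\mu$). Then: 1. there is a unique $k$-polycosymplectic structure $(\omega_\mu^a,\eta_\mu^a)$ on $M_\mu$ with $\pi_\mu^*\omega^a_\mu=j_\mu^*\omega^a$ and $\pi_\mu^*\eta^a_\mu=j_\mu^*\eta^a$, and a unique smooth function $h_\mu$ on $M_\mu$ with $h_\mu\circ\pi_\mu=H\circ j_\mu$; 2. $\mathbf X$ restricts to a unique $k$-vector field $\mathbf X_\mu$ on $J^{-1}(\mu)$ (with $Tj_\mu\circ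 (X_\mu)_a=X_a\circ j_\mu$), and $\mathbf X_\mu$ projects to a unique $k$-vector field $\overline{\mathbf X}_\mu$ on $M_\mu$ (with $T\pi_\mu\circ (X_\mu)_a=(\overline X_\mu)_a\circ\pi_\mu$); 3. $\overline{\mathbf X}_\mu$ solves the $k$-cosymplectic Hamilton equations on $(M_\mu,\omega^a_\mu,\eta^a_\mu)$ for the Hamiltonian $h_\mu$. -/

import Mathlib

open scoped Manifold ContDiff Topology

noncomputable section

/-! ### Differential forms on manifolds -/

/-- A (not necessarily smooth) differential `n`-form on a manifold `M` modelled on `E`. -/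
abbrev DiffForm (E : Type*) [NormedAddCommGroup E] [NormedSpace ℝ E] (M : Type*)
    [TopologicalSpace M] [ChartedSpace E M] (n : ℕ) : Type _ :=
  ∀ x : M, TangentSpace 𝓘(ℝ, E) x [⋀^Fin n]→L[ℝ] ℝ

namespace DiffForm

variable {E : Type*} [NormedAddCommGroup E] [NormedSpace ℝ E]
  {M : Type*} [TopologicalSpace M] [ChartedSpace E M]
  {F : Type*} [NormedAddCommGroup F] [NormedSpace ℝ F]
  {N : Type*} [TopologicalSpace N] [ChartedSpace F N] {n : ℕ}

/-- The coordinate expression of a form in the preferred chart `φ` at `x₀`, i.e. `(φ⁻¹)^* Ω`;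
it is meaningful on the (open) target of the chart. -/
def chartRep (Ω : DiffForm E M n) (x₀ : M) : E → E [⋀^Fin n]→L[ℝ] ℝ := fun y =>
  (Ω ((extChartAt 𝓘(ℝ, E) x₀).symm y)).compContinuousLinearMap
    (mfderiv 𝓘(ℝ, E) 𝓘(ℝ, E) (extChartAt 𝓘(ℝ, E) x₀).symm y)

/-- A form is smooth if all its coordinate expressions are smooth. -/
def IsSmooth (Ω : DiffForm E M n) : Prop :=
  ∀ x₀ : M, ContDiffOn ℝ ∞ (Ω.chartRep x₀) (extChartAt 𝓘(ℝ, E) x₀).target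

/-- A form is closed if the exterior derivative of each of its coordinate expressions vanishes. -/
def IsClosed (Ω : DiffForm E M n) : Prop :=
  ∀ x₀ : M, ∀ y ∈ (extChartAt 𝓘(ℝ, E) x₀).target, extDeriv (Ω.chartRep x₀) y = 0

/-- The pullback `f^* Ω`. -/
def pullback (f : N → M) (Ω : DiffForm E M n) : DiffForm F N n := fun x =>
  (Ω (f x)).compContinuousLinearMap (mfderiv 𝓘(ℝ, F) 𝓘(ℝ, E) f x)

/-- The kernel `{v ∈ T_x M | i_v Ω = 0}` of a `2`-form at `x`. -/
def ker₂ (Ω : DiffForm E M 2) (x : M) : Submodule ℝ (TangentSpace 𝓘(ℝ, E) x) where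
  carrier := {v | ∀ w, Ω x ![v, w] = 0}
  zero_mem' w := (Ω x).map_coord_zero 0 rfl
  add_mem' {v v'} hv hv' w := by
    have h := (Ω x).toAlternatingMap.map_vecCons_add ![w] v v'
    have h1 : Ω x ![v + v', w] = Ω x ![v, w] + Ω x ![v', w] := h
    rw [h1, hv w, hv' w, add_zero]
  smul_mem' c v hv w := by
    have h1 : Ω x ![c • v, w] = c • Ω x ![v, w] :=
      (Ω x).toAlternatingMap.map_vecCons_smul ![w] c v
    rw [h1, hv w, smul_zero]

/-- A `1`-form at `x`, regarded as a covector. -/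
def covector (η : DiffForm E M 1) (x : M) : TangentSpace 𝓘(ℝ, E) x →L[ℝ] ℝ :=
  (ContinuousAlternatingMap.ofSubsingleton ℝ (TangentSpace 𝓘(ℝ, E) x) ℝ (0 : Fin 1)).symm (η x)

/-- The value of `η¹ ∧ ⋯ ∧ ηᵏ` at `x` on `v₁, …, v_k`, namely `det (ηᵃ(v_b))`. -/
def wedge {k : ℕ} (η : Fin k → DiffForm E M 1) (x : M)
    (v : Fin k → TangentSpace 𝓘(ℝ, E) x) : ℝ :=
  Matrix.det (Matrix.of fun a b => (η a).covector x (v b))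

end DiffForm

/-- The differential `dH` of a real function at `x`. -/
def dFun {E : Type*} [NormedAddCommGroup E] [NormedSpace ℝ E] {M : Type*} [TopologicalSpace M]
    [ChartedSpace E M] (H : M → ℝ) (x : M) : TangentSpace 𝓘(ℝ, E) x →L[ℝ] ℝ :=
  mfderiv 𝓘(ℝ, E) 𝓘(ℝ, ℝ) H x

/-! ### Polycosymplectic structures -/

/-- A `k`-polycosymplectic structure on the manifold `M` (modelled on `E`). -/
@[ext]
structure PolycosymplecticStructure (k : ℕ) (E : Type*) [NormedAddCommGroup E] [NormedSpace ℝ E]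
    (M : Type*) [TopologicalSpace M] [ChartedSpace E M] where
  Ω : Fin k → DiffForm E M 2
  η : Fin k → DiffForm E M 1
  smooth_Ω : ∀ a, (Ω a).IsSmooth
  smooth_η : ∀ a, (η a).IsSmooth
  closed_Ω : ∀ a, (Ω a).IsClosed
  closed_η : ∀ a, (η a).IsClosed
  wedge_ne_zero : ∀ x, DiffForm.wedge η x ≠ 0
  ker_inf_ker : ∀ x, (⨅ a, (Ω a).ker₂ x) ⊓ (⨅ a, LinearMap.ker ((η a).covector x).toLinearMap) = ⊥
  finrank_ker : ∀ x, Module.finrank ℝ ↥(⨅ a, (Ω a).ker₂ x) = k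

/-- A `k`-vector field: `k` smooth vector fields. -/
@[ext]
structure KVectorField (k : ℕ) (E : Type*) [NormedAddCommGroup E] [NormedSpace ℝ E]
    (M : Type*) [TopologicalSpace M] [ChartedSpace E M] [IsManifold 𝓘(ℝ, E) ∞ M] where
  toFun : Fin k → ∀ x : M, TangentSpace 𝓘(ℝ, E) x
  smooth : ∀ a, ContMDiff 𝓘(ℝ, E) 𝓘(ℝ, E).tangent ∞
    (fun x => (⟨x, toFun a x⟩ : TangentBundle 𝓘(ℝ, E) M))

namespace PolycosymplecticStructure

variable {k : ℕ} {E : Type*} [NormedAddCommGroup E] [NormedSpace ℝ E]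
  {M : Type*} [TopologicalSpace M] [ChartedSpace E M]

theorem existsUnique_reeb [FiniteDimensional ℝ E] (S : PolycosymplecticStructure k E M) (x : M) :
    ∃! R : Fin k → TangentSpace 𝓘(ℝ, E) x,
      (∀ a b w, S.Ω b x ![R a, w] = 0) ∧
      (∀ a b, (S.η b).covector x (R a) = if a = b then 1 else 0) := by
  have : FiniteDimensional ℝ (TangentSpace 𝓘(ℝ, E) x) := ‹FiniteDimensional ℝ E›
  have hker : ∀ v : TangentSpace 𝓘(ℝ, E) x,
      v ∈ (⨅ a, (S.Ω a).ker₂ x) ↔ ∀ b w, S.Ω b x ![v, w] = 0 := fun v => by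
    rw [Submodule.mem_iInf]
    exact Iff.rfl
  let L : ↥(⨅ a, (S.Ω a).ker₂ x) →ₗ[ℝ] (Fin k → ℝ) :=
    (LinearMap.pi fun b => ((S.η b).covector x).toLinearMap).comp (Submodule.subtype _)
  have hL : ∀ v b, L v b = (S.η b).covector x v.1 := fun _ _ => rfl
  have hinj : Function.Injective L := by
    rw [← LinearMap.ker_eq_bot, LinearMap.ker_eq_bot']
    intro v hv
    have h : v.1 ∈ (⨅ a, (S.Ω a).ker₂ x) ⊓
        (⨅ a, LinearMap.ker ((S.η a).covector x).toLinearMap) := by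
      refine ⟨v.2, (Submodule.mem_iInf _).2 fun b => ?_⟩
      exact congrFun hv b
    rw [S.ker_inf_ker x, Submodule.mem_bot] at h
    exact Subtype.ext h
  have hsurj : Function.Surjective L := by
    refine (LinearMap.injective_iff_surjective_of_finrank_eq_finrank ?_).1 hinj
    rw [S.finrank_ker x, Module.finrank_fin_fun]
  choose R hR using fun a : Fin k => hsurj (fun b => if a = b then 1 else 0)
  refine ⟨fun a => (R a).1, ⟨fun a => (hker _).1 (R a).2, fun a b => ?_⟩, ?_⟩
  · rw [← hL, hR]
  · rintro R' ⟨h1, h2⟩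
    funext a
    have h : (⟨R' a, (hker _).2 (h1 a)⟩ : ↥(⨅ a, (S.Ω a).ker₂ x)) = R a := by
      apply hinj
      rw [hR]
      funext b
      exact h2 a b
    exact congrArg Subtype.val h

/-- The Reeb vector field `R_a`, characterised by `i_{R_a} Ωᵇ = 0` and `ηᵇ(R_a) = δ_a^b`. -/
def reeb [FiniteDimensional ℝ E] (S : PolycosymplecticStructure k E M) (a : Fin k) (x : M) :
    TangentSpace 𝓘(ℝ, E) x :=
  (S.existsUnique_reeb x).choose a

/-- The Reeb distribution `span {R_1, …, R_k}` at `x`. -/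
def reebDist [FiniteDimensional ℝ E] (S : PolycosymplecticStructure k E M) (x : M) :
    Submodule ℝ (TangentSpace 𝓘(ℝ, E) x) :=
  Submodule.span ℝ (Set.range fun a => S.reeb a x)

/-- The polycosymplectic orthogonal of a subspace `V` of `T_x M`. -/
def orth (S : PolycosymplecticStructure k E M) (x : M)
    (V : Submodule ℝ (TangentSpace 𝓘(ℝ, E) x)) : Submodule ℝ (TangentSpace 𝓘(ℝ, E) x) where
  carrier := {v | ∀ a, ∀ s ∈ V, S.Ω a x ![v, s] = 0}
  zero_mem' a s _ := (S.Ω a x).map_coord_zero 0 rfl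
  add_mem' {v v'} hv hv' a s hs := by
    have h1 : S.Ω a x ![v + v', s] = S.Ω a x ![v, s] + S.Ω a x ![v', s] :=
      (S.Ω a x).toAlternatingMap.map_vecCons_add ![s] v v'
    rw [h1, hv a s hs, hv' a s hs, add_zero]
  smul_mem' c v hv a s hs := by
    have h1 : S.Ω a x ![c • v, s] = c • S.Ω a x ![v, s] :=
      (S.Ω a x).toAlternatingMap.map_vecCons_smul ![s] c v
    rw [h1, hv a s hs, smul_zero]

/-- `X` solves the `k`-cosymplectic Hamilton equations for `H`:
`ηᵃ(X_b) = δᵃ_b` and `∑ₐ i_{X_a} Ωᵃ = dH - ∑ₐ R_a(H) ηᵃ`. -/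
def SolvesHamilton [FiniteDimensional ℝ E] [IsManifold 𝓘(ℝ, E) ∞ M]
    (S : PolycosymplecticStructure k E M) (X : KVectorField k E M) (H : M → ℝ) : Prop :=
  (∀ x a b, (S.η a).covector x (X.toFun b x) = if a = b then 1 else 0) ∧
  ∀ (x : M) (w : TangentSpace 𝓘(ℝ, E) x),
    ∑ a, S.Ω a x ![X.toFun a x, w] =
      dFun H x w - ∑ a, dFun H x (S.reeb a x) * (S.η a).covector x w

end PolycosymplecticStructure

/-- The `k`-vector fields `X` on `N` and `Y` on `M` are `f`-related: `Tf (X_a(p)) = Y_a(f(p))`. -/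
def KVectorField.IsRelated {k : ℕ} {F : Type*} [NormedAddCommGroup F] [NormedSpace ℝ F]
    {N : Type*} [TopologicalSpace N] [ChartedSpace F N] [IsManifold 𝓘(ℝ, F) ∞ N]
    {E : Type*} [NormedAddCommGroup E] [NormedSpace ℝ E]
    {M : Type*} [TopologicalSpace M] [ChartedSpace E M] [IsManifold 𝓘(ℝ, E) ∞ M]
    (X : KVectorField k F N) (f : N → M) (Y : KVectorField k E M) : Prop :=
  ∀ a (p : N), mfderiv 𝓘(ℝ, F) 𝓘(ℝ, E) f p (X.toFun a p) = Y.toFun a (f p)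

/-- `π^* Ω'ᵃ = j^* Ωᵃ` and `π^* η'ᵃ = j^* ηᵃ`, for maps `j : P → M` and `π : P → Q`. -/
structure IsReducedStructure {k : ℕ} {E : Type*} [NormedAddCommGroup E] [NormedSpace ℝ E]
    {M : Type*} [TopologicalSpace M] [ChartedSpace E M]
    (EP : Type*) [NormedAddCommGroup EP] [NormedSpace ℝ EP]
    {P : Type*} [TopologicalSpace P] [ChartedSpace EP P]
    {EQ : Type*} [NormedAddCommGroup EQ] [NormedSpace ℝ EQ]
    {Q : Type*} [TopologicalSpace Q] [ChartedSpace EQ Q]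
    (S : PolycosymplecticStructure k E M) (S' : PolycosymplecticStructure k EQ Q)
    (j : P → M) (π : P → Q) : Prop where
  pullback_Ω : ∀ a, (S'.Ω a).pullback (F := EP) π = (S.Ω a).pullback (F := EP) j
  pullback_η : ∀ a, (S'.η a).pullback (F := EP) π = (S.η a).pullback (F := EP) j

/-! ### Lie groups: adjoint and coadjoint action, isotropy group

Let `G` be a Lie group modelled on `EG`. Its Lie algebra is `T_1 G`, which in Mathlib is by
definition the vector space `EG` (written in the preferred chart at `1`). Accordingly `𝔤` is
`EG`, and `𝔤*` is `EG →L[ℝ] ℝ`. -/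

section LieGroup

variable {k : ℕ} {EG : Type*} [NormedAddCommGroup EG] [NormedSpace ℝ EG]
  {G : Type*} [TopologicalSpace G] [ChartedSpace EG G] [Group G]

/-- The adjoint representation `Ad_g = T_1 (h ↦ g h g⁻¹)`. -/
def lieAd (g : G) : EG →L[ℝ] EG :=
  mfderiv 𝓘(ℝ, EG) 𝓘(ℝ, EG) (fun h : G => g * h * g⁻¹) 1

/-- The `k`-coadjoint action: `(μ_1, …, μ_k) ↦ (Ad*_{g⁻¹} μ_1, …, Ad*_{g⁻¹} μ_k)`, where
`Ad*_{g⁻¹} μ = μ ∘ Ad_{g⁻¹}`. -/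
def coad (g : G) (μ : Fin k → EG →L[ℝ] ℝ) : Fin k → EG →L[ℝ] ℝ :=
  fun a => (μ a).comp (lieAd g⁻¹)

theorem lieAd_one : lieAd (1 : G) = ContinuousLinearMap.id ℝ EG := by
  have h : (fun h : G => 1 * h * 1⁻¹) = id := by
    funext h
    simp
  unfold lieAd
  rw [h]
  exact mfderiv_id

theorem lieAd_mul [LieGroup 𝓘(ℝ, EG) ∞ G] (g h : G) :
    (lieAd (g * h) : EG →L[ℝ] EG) = (lieAd g).comp (lieAd h) := by
  have hs : ∀ g : G, ContMDiff 𝓘(ℝ, EG) 𝓘(ℝ, EG) ∞ (fun x : G => g * x * g⁻¹) := fun g =>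
    (contMDiff_mul_right (a := g⁻¹)).comp (contMDiff_mul_left (a := g))
  have hd : ∀ g x : G, MDifferentiableAt 𝓘(ℝ, EG) 𝓘(ℝ, EG) (fun x : G => g * x * g⁻¹) x :=
    fun g x => (hs g).mdifferentiable (by simp) x
  have hcomp : (fun x : G => g * h * x * (g * h)⁻¹) =
      (fun x : G => g * x * g⁻¹) ∘ (fun x : G => h * x * h⁻¹) := by
    funext x
    simp [mul_assoc]
  unfold lieAd
  rw [hcomp, mfderiv_comp (1 : G) (hd g _) (hd h 1)]
  have h1 : h * 1 * h⁻¹ = 1 := by simp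
  ext v
  simp only [ContinuousLinearMap.comp_apply]
  congr 2

theorem coad_one (μ : Fin k → EG →L[ℝ] ℝ) : coad (1 : G) μ = μ := by
  funext a
  simp [coad, lieAd_one]

theorem coad_mul [LieGroup 𝓘(ℝ, EG) ∞ G] (g h : G) (μ : Fin k → EG →L[ℝ] ℝ) :
    coad (g * h) μ = coad g (coad h μ) := by
  funext a
  simp [coad, lieAd_mul, ContinuousLinearMap.comp_assoc]

variable (G) in
/-- The isotropy group `G_μ` of `μ` under the `k`-coadjoint action. -/
def isotropyGroup [LieGroup 𝓘(ℝ, EG) ∞ G] (μ : Fin k → EG →L[ℝ] ℝ) : Subgroup G where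
  carrier := {g | coad g μ = μ}
  one_mem' := coad_one μ
  mul_mem' {g h} hg hh := by
    change coad (g * h) μ = μ
    rw [coad_mul, show coad h μ = μ from hh, show coad g μ = μ from hg]
  inv_mem' {g} hg := by
    change coad g⁻¹ μ = μ
    conv_lhs => rw [← show coad g μ = μ from hg]
    rw [← coad_mul, inv_mul_cancel, coad_one]

/-- The Lie algebra of a closed subgroup `K` of `G`: the velocities at `0` of the one-parameter
subgroups of `G` which lie in `K`. (For closed `K` these already form a linear subspace.) -/
def lieAlgebraOf (K : Subgroup G) : Submodule ℝ EG :=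
  Submodule.span ℝ {ξ : EG | ∃ γ : ℝ → G, ContMDiff 𝓘(ℝ, ℝ) 𝓘(ℝ, EG) ∞ γ ∧
    (∀ s t, γ (s + t) = γ s * γ t) ∧ (∀ t, γ t ∈ K) ∧
    mfderiv 𝓘(ℝ, ℝ) 𝓘(ℝ, EG) γ 0 (1 : ℝ) = ξ}

end LieGroup

/-! ### Actions, momentum maps, reduced spaces -/

section Action

variable {k : ℕ} {E : Type*} [NormedAddCommGroup E] [NormedSpace ℝ E]
  {M : Type*} [TopologicalSpace M] [ChartedSpace E M]
  {EG : Type*} [NormedAddCommGroup EG] [NormedSpace ℝ EG]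
  (G : Type*) [TopologicalSpace G] [ChartedSpace EG G] [Group G] [MulAction G M]

/-- The infinitesimal generators at `x`: the map `ξ ↦ ξ_M(x) = T_1 (g ↦ g • x) ξ`. -/
def infGen (x : M) : EG →L[ℝ] TangentSpace 𝓘(ℝ, E) x :=
  mfderiv 𝓘(ℝ, EG) 𝓘(ℝ, E) (fun g : G => g • x) 1

/-- The subspace `{ξ_M(x) | ξ ∈ 𝔤}` of `T_x M`. -/
def verticalSpace (x : M) : Submodule ℝ (TangentSpace 𝓘(ℝ, E) x) :=
  LinearMap.range (infGen (E := E) (EG := EG) G x).toLinearMap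

/-- The subspace `{ξ_M(x) | ξ ∈ 𝔤_μ}` of `T_x M`, where `𝔤_μ` is the Lie algebra of `G_μ`. -/
def isotropyVerticalSpace [LieGroup 𝓘(ℝ, EG) ∞ G] (μ : Fin k → EG →L[ℝ] ℝ) (x : M) :
    Submodule ℝ (TangentSpace 𝓘(ℝ, E) x) :=
  (lieAlgebraOf (isotropyGroup G μ)).map (infGen (E := E) (EG := EG) G x).toLinearMap

variable (EG) in
/-- The action of `G` on `(M, Ωᵃ, ηᵃ)` is polycosymplectic:
`Φ_g^* Ωᵃ = Ωᵃ` and `i_{ξ_M} ηᵃ = 0`. -/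
structure IsPolycosymplecticAction (S : PolycosymplecticStructure k E M) : Prop where
  pullback_Ω : ∀ (g : G) a, (S.Ω a).pullback (fun x : M => g • x) = S.Ω a
  contract_η : ∀ a (ξ : EG) (x : M), (S.η a).covector x (infGen G x ξ) = 0

/-- `J` is a (smooth) momentum map, equivariant for the `k`-coadjoint action:
`i_{ξ_M} Ωᵃ = d J^a_ξ`, where `J^a_ξ(x) = ⟨J^a(x), ξ⟩`. -/
structure IsEquivariantMomentumMap (S : PolycosymplecticStructure k E M)
    (J : M → Fin k → EG →L[ℝ] ℝ) : Prop where
  smooth : ContMDiff 𝓘(ℝ, E) 𝓘(ℝ, Fin k → EG →L[ℝ] ℝ) ∞ J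
  momentum : ∀ a (ξ : EG) (x : M) (v : TangentSpace 𝓘(ℝ, E) x),
    S.Ω a x ![infGen G x ξ, v] = dFun (fun y => J y a ξ) x v
  equivariant : ∀ (g : G) (x : M), J (g • x) = coad g (J x)

variable {G} in
/-- `μ` is a regular value of `J`. -/
def IsRegularValue (J : M → Fin k → EG →L[ℝ] ℝ) (μ : Fin k → EG →L[ℝ] ℝ) : Prop :=
  ∀ x, J x = μ → Function.Surjective (mfderiv 𝓘(ℝ, E) 𝓘(ℝ, Fin k → EG →L[ℝ] ℝ) J x)

/-- The level set `J⁻¹(μ)`, with the subspace topology. -/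
abbrev LevelSet {k : ℕ} {M EG : Type*} [NormedAddCommGroup EG] [NormedSpace ℝ EG]
    (J : M → Fin k → EG →L[ℝ] ℝ) (μ : Fin k → EG →L[ℝ] ℝ) : Type _ := {x : M // J x = μ}

/-- The equivalence relation on `J⁻¹(μ)` of lying in the same `G_μ`-orbit. -/
def levelSetSetoid [LieGroup 𝓘(ℝ, EG) ∞ G] (J : M → Fin k → EG →L[ℝ] ℝ)
    (μ : Fin k → EG →L[ℝ] ℝ) : Setoid (LevelSet J μ) :=
  (MulAction.orbitRel (isotropyGroup G μ) M).comap Subtype.val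

/-- The reduced space `M_μ = J⁻¹(μ) / G_μ`, with the quotient topology. -/
abbrev ReducedSpace [LieGroup 𝓘(ℝ, EG) ∞ G] (J : M → Fin k → EG →L[ℝ] ℝ)
    (μ : Fin k → EG →L[ℝ] ℝ) : Type _ := Quotient (levelSetSetoid G J μ)

/-- The projection `π_μ : J⁻¹(μ) → M_μ`. -/
def reducedProj [LieGroup 𝓘(ℝ, EG) ∞ G] (J : M → Fin k → EG →L[ℝ] ℝ)
    (μ : Fin k → EG →L[ℝ] ℝ) : LevelSet J μ → ReducedSpace G J μ := Quotient.mk _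

end Action

end

/-! Everything happens on `J⁻¹(μ)`. Since `Ωᵃ(ξ_M, v) = ⟨dJᵃ v, ξ⟩`, the orthogonal of the orbit
directions is `ker dJ`, which along `J⁻¹(μ)` is the tangent space of the level set
(`mem_orth_verticalSpace`, `exists_mfderiv_val_eq`). Generators are therefore orthogonal to all
vectors tangent to `J⁻¹(μ)`, and together with invariance this makes the restricted 2-forms basic
for `π_μ` (`pullback_Ω_basic`). Invariance of the 1-forms is derived: a closed form killing the
generators of a connected group is invariant (`DiffForm.IsClosed.pullback_smul`), so they are basic
too. The descended forms are smooth and closed because locally they are pullbacks along `j ∘ σ`,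
with `σ` a local section of `π_μ` (`DiffForm.exists_local_pullback`).

The real point is nondegeneracy. Reeb vectors lie in every kernel `ker Ωᵃ`, hence are tangent to
`J⁻¹(μ)`, and their projections satisfy the Reeb relations downstairs (`reduced_reeb_spec`). If `Tπ
u` lies in the common kernel of the reduced 2-forms, then `Tj u` lies in `𝔤̃^{cω} ∩ 𝔤̃^{cω cω}`. The
hypothesis splits it into a Reeb combination and a `𝔤_μ`-direction, and `Tπ` kills the latter
(`mem_span_of_reduced_apply_eq_zero`). So the common kernel is spanned by the projected Reeb
vectors, and their duality with the reduced 1-forms gives all three pointwise axioms.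

For the dynamics, the forms, the Reeb vectors, the differentials of the Hamiltonians and the
`k`-vector fields all correspond under `Tj` and `Tπ`. The reduced equations at `Tπ u` are thus the
original ones at `Tj u` (`solvesHamilton_reduced`).

The embedding and the submersion are exploited only through local retractions and local sections.
Freeness and properness serve to show that the kernel of `Tπ` consists of orbit directions. -/

noncomputable section

open Set Filter Function

set_option linter.unusedSectionVars false

/-! ### Smooth dependence of pullbacks of alternating maps. -/

section Alternating

variable {ι : Type*} [Fintype ι] [DecidableEq ι]
  {E F G W : Type*} [NormedAddCommGroup E] [NormedSpace ℝ E] [NormedAddCommGroup F]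
  [NormedSpace ℝ F] [NormedAddCommGroup G] [NormedSpace ℝ G]
  [NormedAddCommGroup W] [NormedSpace ℝ W]

/-- Alternatization as a continuous linear map. -/
def alternatizationL : ContinuousMultilinearMap ℝ (fun _ : ι => E) G →L[ℝ] E [⋀^ι]→L[ℝ] G :=
  LinearMap.mkContinuous
    { toFun := fun f => ContinuousMultilinearMap.alternatization f
      map_add' := fun f g => map_add _ f g
      map_smul' := fun c f => by
        ext v
        simp only [ContinuousMultilinearMap.alternatization_apply_apply,
          _root_.smul_apply, RingHom.id_apply,
          ContinuousAlternatingMap.smul_apply, Finset.smul_sum]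
        exact Finset.sum_congr rfl fun σ _ => smul_comm _ _ _ }
    (Fintype.card (Equiv.Perm ι)) fun f => by
      refine ContinuousAlternatingMap.opNorm_le_bound _ (by positivity) fun v => ?_
      have : ∀ σ : Equiv.Perm ι, ‖Equiv.Perm.sign σ • f (v ∘ σ)‖ ≤ ‖f‖ * ∏ i, ‖v i‖ := by
        intro σ
        have h1 : ‖Equiv.Perm.sign σ • f (v ∘ σ)‖ = ‖f (v ∘ σ)‖ := by
          -- Each of the `n!` terms has norm at most `‖f‖ ∏ ‖v i‖`, whence the bound `n!` on the
          -- operator norm.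
          rcases Int.units_eq_one_or (Equiv.Perm.sign σ) with h | h <;> simp [h, Units.smul_def]
        rw [h1]
        refine (f.le_opNorm _).trans_eq ?_
        congr 1
        exact Equiv.prod_comp σ fun i => ‖v i‖
      refine ((congrArg norm
        (ContinuousMultilinearMap.alternatization_apply_apply f v)).trans_le
          (norm_sum_le_of_le _ fun σ _ => this σ)).trans_eq ?_
      simp [mul_assoc]

theorem alternatizationL_coe (f : E [⋀^ι]→L[ℝ] G) :
    alternatizationL f.toContinuousMultilinearMap = (Fintype.card ι).factorial • f := by
  ext v
  have := congrArg (fun g => g v) (AlternatingMap.coe_alternatization f.toAlternatingMap)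
  simp only [MultilinearMap.alternatization_apply] at this
  change ContinuousMultilinearMap.alternatization f.toContinuousMultilinearMap v = _
  rw [ContinuousMultilinearMap.alternatization_apply_apply]
  exact this

/-- For multilinear maps, composition is linear in the form and multilinear in the linear maps,
hence smooth. Alternatization divided by `n!` is a continuous linear retraction back onto
alternating maps. -/
theorem ContDiffAt.continuousAlternatingMapCompContinuousLinearMap {m : ℕ∞ω}
    {f : W → F [⋀^ι]→L[ℝ] G} {g : W → E →L[ℝ] F} {x : W}
    (hf : ContDiffAt ℝ m f x) (hg : ContDiffAt ℝ m g x) :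
    ContDiffAt ℝ m (fun w => (f w).compContinuousLinearMap (g w)) x := by
  have h : (fun w => (f w).compContinuousLinearMap (g w)) = fun w =>
      ((Fintype.card ι).factorial : ℝ)⁻¹ • alternatizationL
        (ContinuousMultilinearMap.compContinuousLinearMapContinuousMultilinear ℝ
          (fun _ : ι => E) (fun _ : ι => F) G (fun _ => g w)
          (ContinuousAlternatingMap.toContinuousMultilinearMapCLM ℝ (f w))) := by
    funext w
    have h1 : ContinuousMultilinearMap.compContinuousLinearMapContinuousMultilinear ℝ
          (fun _ : ι => E) (fun _ : ι => F) G (fun _ => g w)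
          (ContinuousAlternatingMap.toContinuousMultilinearMapCLM ℝ (f w)) =
        ((f w).compContinuousLinearMap (g w)).toContinuousMultilinearMap := rfl
    rw [h1, alternatizationL_coe, ← Nat.cast_smul_eq_nsmul ℝ, smul_smul, inv_mul_cancel₀, one_smul]
    exact_mod_cast Nat.factorial_ne_zero _
  rw [h]
  have h2 : ContDiff ℝ m (alternatizationL :
      ContinuousMultilinearMap ℝ (fun _ : ι => E) G → E [⋀^ι]→L[ℝ] G) :=
    ContinuousLinearMap.contDiff _
  refine ContDiffAt.const_smul _ (h2.contDiffAt.comp x (ContDiffAt.clm_apply ?_ ?_))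
  · exact (ContinuousMultilinearMap.contDiff _).contDiffAt.comp x (contDiffAt_pi.2 fun _ => hg)
  · exact (ContinuousLinearMap.contDiff _).contDiffAt.comp x hf

end Alternating

/-! ### Immersions and submersions in adapted charts: retractions, sections, curves in fibres. -/

section Charts

variable {E : Type*} [NormedAddCommGroup E] [NormedSpace ℝ E]
  {M : Type*} [TopologicalSpace M] [ChartedSpace E M]
  {F : Type*} [NormedAddCommGroup F] [NormedSpace ℝ F]
  {N : Type*} [TopologicalSpace N] [ChartedSpace F N]

theorem contMDiffAt_extChartAt_symm [IsManifold 𝓘(ℝ, E) ∞ M] (x : M) {y : E} (hy : y ∈ (extChartAt 𝓘(ℝ, E) x).target) :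
    ContMDiffAt 𝓘(ℝ, E) 𝓘(ℝ, E) ∞ (extChartAt 𝓘(ℝ, E) x).symm y :=
  (contMDiffOn_extChartAt_symm x).contMDiffAt ((isOpen_extChartAt_target x).mem_nhds hy)

/-- Near a point of the domain, an immersion has a smooth left inverse. -/
theorem Manifold.IsImmersionAt.exists_retraction {f : N → M} {p : N}
    (hf : Manifold.IsImmersionAt 𝓘(ℝ, F) 𝓘(ℝ, E) ∞ f p) :
    ∃ r : M → N, (∀ᶠ x in 𝓝 (f p), ContMDiffAt 𝓘(ℝ, E) 𝓘(ℝ, F) ∞ r x) ∧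
      ∀ᶠ q in 𝓝 p, r (f q) = q := by
  set φ := hf.domChart
  set ψ := hf.codChart
  -- In adapted charts the immersion is `u ↦ (u, 0)`; the retraction forgets the second coordinate.
  let A : E → F := fun y => (hf.equiv.symm y).1
  have hA : ContDiff ℝ ∞ A := by fun_prop
  have hr : ∀ q ∈ φ.source, A (ψ.extend 𝓘(ℝ, E) (f q)) = φ.extend 𝓘(ℝ, F) q := by
    intro q hq
    have h := hf.writtenInCharts ((φ.extend 𝓘(ℝ, F)).map_source
      (by simpa only [OpenPartialHomeomorph.extend_source] using hq))
    simp only [comp_apply] at h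
    rw [φ.extend_left_inv hq] at h
    simp only [A]
    erw [h]
    simp
  refine ⟨fun x => (φ.extend 𝓘(ℝ, F)).symm (A (ψ.extend 𝓘(ℝ, E) x)), ?_, ?_⟩
  · have hs : ContinuousAt (fun x => A (ψ.extend 𝓘(ℝ, E) x)) (f p) :=
      hA.continuous.continuousAt.comp (ψ.continuousAt_extend hf.mem_codChart_source)
    have h1 : ∀ᶠ x in 𝓝 (f p), A (ψ.extend 𝓘(ℝ, E) x) ∈ (φ.extend 𝓘(ℝ, F)).target := by
      refine hs ((φ.isOpen_extend_target).mem_nhds ?_)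
      simp only [hr p hf.mem_domChart_source]
      exact (φ.extend 𝓘(ℝ, F)).map_source
        (by simpa only [OpenPartialHomeomorph.extend_source] using hf.mem_domChart_source)
    filter_upwards [h1, ψ.open_source.mem_nhds hf.mem_codChart_source] with x hx hx'
    have h2 : ContMDiffAt 𝓘(ℝ, F) 𝓘(ℝ, F) ∞ (φ.extend 𝓘(ℝ, F)).symm
        (A (ψ.extend 𝓘(ℝ, E) x)) := by
      have := contMDiffOn_extend_symm (I := 𝓘(ℝ, F)) hf.domChart_mem_maximalAtlas
      refine this.contMDiffAt (IsOpen.mem_nhds ?_ ?_)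
      · simpa using φ.open_target
      · simpa using hx
    exact h2.comp x (hA.contMDiff.contMDiffAt.comp x
      (ψ.contMDiffAt_extend hf.codChart_mem_maximalAtlas hx'))
  · filter_upwards [φ.open_source.mem_nhds hf.mem_domChart_source] with q hq
    rw [hr q hq, φ.extend_left_inv hq]

/-- A submersion has smooth local sections through each point. -/
theorem Manifold.IsSubmersionAt.exists_section {f : N → M} {p : N}
    (hf : Manifold.IsSubmersionAt 𝓘(ℝ, F) 𝓘(ℝ, E) ∞ f p) :
    ∃ σ : M → N, σ (f p) = p ∧
      ∀ᶠ x in 𝓝 (f p), ContMDiffAt 𝓘(ℝ, E) 𝓘(ℝ, F) ∞ σ x ∧ f (σ x) = x := by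
  set φ := hf.domChart
  set ψ := hf.codChart
  have hp : p ∈ φ.source := hf.mem_domChart_source
  have hfp : f p ∈ ψ.source := hf.mem_codChart_source
  have hps : p ∈ (φ.extend 𝓘(ℝ, F)).source := by
    simpa only [OpenPartialHomeomorph.extend_source] using hp
  -- In adapted charts the submersion is the first projection. Freezing the second coordinate at its
  -- value at `p` makes the section pass through `p`.
  let A : E → F := fun y => hf.equiv.symm (y, (hf.equiv (φ.extend 𝓘(ℝ, F) p)).2)
  have hA : ContDiff ℝ ∞ A := by fun_prop
  have hAp : A (ψ.extend 𝓘(ℝ, E) (f p)) = φ.extend 𝓘(ℝ, F) p := by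
    have h := hf.writtenInCharts ((φ.extend 𝓘(ℝ, F)).map_source hps)
    simp only [comp_apply] at h
    rw [φ.extend_left_inv hp] at h
    simp only [A]
    erw [h]
    simp
  refine ⟨fun x => (φ.extend 𝓘(ℝ, F)).symm (A (ψ.extend 𝓘(ℝ, E) x)), ?_, ?_⟩
  · simp only [hAp]
    exact φ.extend_left_inv hp
  · have hs : ContinuousAt (fun x => A (ψ.extend 𝓘(ℝ, E) x)) (f p) :=
      hA.continuous.continuousAt.comp (ψ.continuousAt_extend hfp)
    have h1 : ∀ᶠ x in 𝓝 (f p), A (ψ.extend 𝓘(ℝ, E) x) ∈ (φ.extend 𝓘(ℝ, F)).target := by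
      refine hs ((φ.isOpen_extend_target).mem_nhds ?_)
      simp only [hAp]
      exact (φ.extend 𝓘(ℝ, F)).map_source hps
    filter_upwards [h1, ψ.open_source.mem_nhds hfp] with x hx hx'
    have h2 : ContMDiffAt 𝓘(ℝ, F) 𝓘(ℝ, F) ∞ (φ.extend 𝓘(ℝ, F)).symm
        (A (ψ.extend 𝓘(ℝ, E) x)) := by
      have := contMDiffOn_extend_symm (I := 𝓘(ℝ, F)) hf.domChart_mem_maximalAtlas
      refine this.contMDiffAt (IsOpen.mem_nhds ?_ ?_)
      · simpa using φ.open_target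
      · simpa using hx
    refine ⟨h2.comp x (hA.contMDiff.contMDiffAt.comp x
      (ψ.contMDiffAt_extend hf.codChart_mem_maximalAtlas hx')), ?_⟩
    have h := hf.writtenInCharts hx
    simp only [comp_apply] at h
    have h3 : (φ.extend 𝓘(ℝ, F)).symm (A (ψ.extend 𝓘(ℝ, E) x)) ∈ φ.source := by
      simpa only [OpenPartialHomeomorph.extend_source] using (φ.extend 𝓘(ℝ, F)).map_target hx
    refine (ψ.extend 𝓘(ℝ, E)).injOn ?_ ?_ (h.trans ?_)
    · rw [OpenPartialHomeomorph.extend_source]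
      exact hf.source_subset_preimage_source h3
    · rwa [OpenPartialHomeomorph.extend_source]
    · simp [A]

/-- A vector killed by the differential of a submersion is the velocity of a curve in the fibre. -/
theorem Manifold.IsSubmersionAt.exists_curve {f : N → M} {p : N}
    (hf : Manifold.IsSubmersionAt 𝓘(ℝ, F) 𝓘(ℝ, E) ∞ f p) (v : TangentSpace 𝓘(ℝ, F) p)
    (hv : mfderiv 𝓘(ℝ, F) 𝓘(ℝ, E) f p v = 0) :
    ∃ c : ℝ → N, c 0 = p ∧ MDifferentiableAt 𝓘(ℝ, ℝ) 𝓘(ℝ, F) c 0 ∧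
      (mfderiv 𝓘(ℝ, ℝ) 𝓘(ℝ, F) c 0 (1 : ℝ) : F) = v ∧ ∀ᶠ t in 𝓝 0, f (c t) = f p := by
  set φ := hf.domChart
  set ψ := hf.codChart
  have hp : p ∈ φ.source := hf.mem_domChart_source
  have hfp : f p ∈ ψ.source := hf.mem_codChart_source
  have hps : p ∈ (φ.extend 𝓘(ℝ, F)).source := by
    simpa only [OpenPartialHomeomorph.extend_source] using hp
  have hφ : ContMDiffAt 𝓘(ℝ, F) 𝓘(ℝ, F) ∞ (φ.extend 𝓘(ℝ, F)) p :=
    φ.contMDiffAt_extend hf.domChart_mem_maximalAtlas hp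
  have hψ : ContMDiffAt 𝓘(ℝ, E) 𝓘(ℝ, E) ∞ (ψ.extend 𝓘(ℝ, E)) (f p) :=
    ψ.contMDiffAt_extend hf.codChart_mem_maximalAtlas hfp
  have hφs : ContMDiffAt 𝓘(ℝ, F) 𝓘(ℝ, F) ∞ (φ.extend 𝓘(ℝ, F)).symm (φ.extend 𝓘(ℝ, F) p) := by
    have := contMDiffOn_extend_symm (I := 𝓘(ℝ, F)) hf.domChart_mem_maximalAtlas
    refine this.contMDiffAt (IsOpen.mem_nhds ?_ ?_)
    · simpa using φ.open_target
    · simpa using φ.map_source hp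
  set w : F := mfderiv 𝓘(ℝ, F) 𝓘(ℝ, F) (φ.extend 𝓘(ℝ, F)) p v with hw
  have hn : (∞ : ℕ∞ω) ≠ 0 := by simp
  have hw0 : (hf.equiv w).1 = 0 := by
    have h1 : (ψ.extend 𝓘(ℝ, E)) ∘ f =ᶠ[𝓝 p]
        (fun y => (hf.equiv y).1) ∘ (φ.extend 𝓘(ℝ, F)) := by
      filter_upwards [φ.open_source.mem_nhds hp] with q hq
      have h := hf.writtenInCharts ((φ.extend 𝓘(ℝ, F)).map_source
        (by simpa only [OpenPartialHomeomorph.extend_source] using hq))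
      simp only [comp_apply] at h
      rw [φ.extend_left_inv hq] at h
      exact h
    have h2 := h1.mfderiv_eq (I := 𝓘(ℝ, F)) (I' := 𝓘(ℝ, E))
    rw [mfderiv_comp p (hψ.mdifferentiableAt hn) (hf.contMDiffAt.mdifferentiableAt hn)] at h2
    have h3 : HasFDerivAt (fun y => (hf.equiv y).1)
        ((ContinuousLinearMap.fst ℝ E hf.complement).comp
          (hf.equiv : F →L[ℝ] E × hf.complement)) (φ.extend 𝓘(ℝ, F) p) :=
      ContinuousLinearMap.hasFDerivAt
        ((ContinuousLinearMap.fst ℝ E hf.complement).comp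
          (hf.equiv : F →L[ℝ] E × hf.complement))
    rw [(h3.hasMFDerivAt.comp p (hφ.mdifferentiableAt hn).hasMFDerivAt).mfderiv] at h2
    have h4 := DFunLike.congr_fun h2 v
    simp only [ContinuousLinearMap.comp_apply] at h4
    rw [hv, map_zero] at h4
    exact h4.symm
  -- The curve is a straight line in the chart; by `hw0` its direction has no base component, so it
  -- stays in the fibre.
  have hl : HasDerivAt (fun t : ℝ => φ.extend 𝓘(ℝ, F) p + t • w) w 0 := by
    simpa using ((hasDerivAt_id (0 : ℝ)).smul_const w).const_add (φ.extend 𝓘(ℝ, F) p)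
  have h0 : φ.extend 𝓘(ℝ, F) p + (0 : ℝ) • w = φ.extend 𝓘(ℝ, F) p := by simp
  have hc : HasMFDerivAt 𝓘(ℝ, ℝ) 𝓘(ℝ, F)
      ((φ.extend 𝓘(ℝ, F)).symm ∘ fun t : ℝ => φ.extend 𝓘(ℝ, F) p + t • w) 0 _ :=
    HasMFDerivAt.comp (0 : ℝ) (by
      rw [h0]; exact (hφs.mdifferentiableAt hn).hasMFDerivAt) hl.hasFDerivAt.hasMFDerivAt
  refine ⟨_, ?_, hc.mdifferentiableAt, ?_, ?_⟩
  · simp only [comp_apply, h0]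
    exact φ.extend_left_inv hp
  · rw [hc.mfderiv]
    have h5 : HasMFDerivAt 𝓘(ℝ, F) 𝓘(ℝ, F) ((φ.extend 𝓘(ℝ, F)).symm ∘ φ.extend 𝓘(ℝ, F)) p _ :=
      (hφs.mdifferentiableAt hn).hasMFDerivAt.comp p (hφ.mdifferentiableAt hn).hasMFDerivAt
    have h6 : (φ.extend 𝓘(ℝ, F)).symm ∘ φ.extend 𝓘(ℝ, F) =ᶠ[𝓝 p] id := by
      filter_upwards [φ.open_source.mem_nhds hp] with q hq
      exact φ.extend_left_inv hq
    have h7 := h6.mfderiv_eq (I := 𝓘(ℝ, F)) (I' := 𝓘(ℝ, F))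
    rw [h5.mfderiv, mfderiv_id] at h7
    have h8 := DFunLike.congr_fun h7 v
    have h9 : (ContinuousLinearMap.toSpanSingleton ℝ w) (1 : ℝ) = w := by simp
    refine Eq.trans ?_ h8
    change mfderiv 𝓘(ℝ, F) 𝓘(ℝ, F) (φ.extend 𝓘(ℝ, F)).symm _ _ = _
    exact congrArg _ h9
  · have h1 : ∀ᶠ t : ℝ in 𝓝 0, φ.extend 𝓘(ℝ, F) p + t • w ∈ (φ.extend 𝓘(ℝ, F)).target := by
      refine hl.continuousAt ((φ.isOpen_extend_target).mem_nhds ?_)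
      simp only [h0]
      exact (φ.extend 𝓘(ℝ, F)).map_source hps
    filter_upwards [h1] with t ht
    have h := hf.writtenInCharts ht
    have hq := hf.writtenInCharts ((φ.extend 𝓘(ℝ, F)).map_source hps)
    simp only [comp_apply] at h hq ⊢
    rw [φ.extend_left_inv hp] at hq
    have h3 : (φ.extend 𝓘(ℝ, F)).symm (φ.extend 𝓘(ℝ, F) p + t • w) ∈ φ.source := by
      simpa only [OpenPartialHomeomorph.extend_source] using (φ.extend 𝓘(ℝ, F)).map_target ht
    refine (ψ.extend 𝓘(ℝ, E)).injOn ?_ ?_ (h.trans (Eq.trans ?_ hq.symm))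
    · rw [OpenPartialHomeomorph.extend_source]
      exact hf.source_subset_preimage_source h3
    · rwa [OpenPartialHomeomorph.extend_source]
    · simp [hw0]

end Charts

/-! ### Pullbacks of forms; smoothness and closedness tested on local pullbacks. -/

namespace DiffForm

variable {E : Type*} [NormedAddCommGroup E] [NormedSpace ℝ E]
  {M : Type*} [TopologicalSpace M] [ChartedSpace E M]
  {F : Type*} [NormedAddCommGroup F] [NormedSpace ℝ F]
  {N : Type*} [TopologicalSpace N] [ChartedSpace F N]
  {W : Type*} [NormedAddCommGroup W] [NormedSpace ℝ W]
  {L : Type*} [TopologicalSpace L] [ChartedSpace W L] {n : ℕ}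

theorem pullback_comp_apply (Ω : DiffForm E M n) {f : N → M} {g : L → N} {x : L}
    (hf : MDifferentiableAt 𝓘(ℝ, F) 𝓘(ℝ, E) f (g x))
    (hg : MDifferentiableAt 𝓘(ℝ, W) 𝓘(ℝ, F) g x) :
    Ω.pullback (F := W) (f ∘ g) x = (Ω.pullback (F := F) f).pullback (F := W) g x := by
  unfold pullback
  rw [mfderiv_comp x hf hg]
  rfl

theorem pullback_congr (Ω : DiffForm E M n) {f g : N → M} {x : N} (h : f =ᶠ[𝓝 x] g) :
    Ω.pullback (F := F) f x = Ω.pullback (F := F) g x := by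
  have h1 := h.mfderiv_eq (I := 𝓘(ℝ, F)) (I' := 𝓘(ℝ, E))
  have h2 : f x = g x := h.eq_of_nhds
  ext v
  simp only [pullback, ContinuousAlternatingMap.compContinuousLinearMap_apply]
  have : ∀ (y y' : M) (hy : y = y') (A B : F →L[ℝ] E) (hAB : A = B),
      (Ω y : E [⋀^Fin n]→L[ℝ] ℝ) (A ∘ v) = (Ω y' : E [⋀^Fin n]→L[ℝ] ℝ) (B ∘ v) := by
    rintro y _ rfl A _ rfl
    rfl
  exact this _ _ h2 _ _ h1

theorem pullback_eq_of_eq (Ω Θ : DiffForm E M n) {f : N → M} {x : N} (h : Ω (f x) = Θ (f x)) :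
    Ω.pullback (F := F) f x = Θ.pullback (F := F) f x := by
  simp only [pullback, h]

theorem covector_eq (η : DiffForm E M 1) (x : M) (v : TangentSpace 𝓘(ℝ, E) x) :
    η.covector x v = η x ![v] := by
  unfold covector
  have : (![v] : Fin 1 → TangentSpace 𝓘(ℝ, E) x) = fun _ => v := by
    funext i; fin_cases i; rfl
  rw [this]
  rfl

theorem pullback_covector (η : DiffForm E M 1) (f : N → M) (x : N) (v : TangentSpace 𝓘(ℝ, F) x) :
    (η.pullback (F := F) f).covector x v =
      η.covector (f x) (mfderiv 𝓘(ℝ, F) 𝓘(ℝ, E) f x v) := by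
  rw [covector_eq, covector_eq, pullback, ContinuousAlternatingMap.compContinuousLinearMap_apply]
  congr 1
  funext i; fin_cases i; rfl

theorem pullback_apply₂ (Ω : DiffForm E M 2) (f : N → M) (x : N) (v w : TangentSpace 𝓘(ℝ, F) x) :
    Ω.pullback (F := F) f x ![v, w] =
      Ω (f x) ![mfderiv 𝓘(ℝ, F) 𝓘(ℝ, E) f x v, mfderiv 𝓘(ℝ, F) 𝓘(ℝ, E) f x w] := by
  rw [pullback, ContinuousAlternatingMap.compContinuousLinearMap_apply]
  congr 1
  funext i; fin_cases i <;> rfl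

/-- The pullback of a form to a normed space, as a form on that space. -/
def coordPullback (f : W → M) (Ω : DiffForm E M n) : W → W [⋀^Fin n]→L[ℝ] ℝ := fun u =>
  Ω.pullback (F := W) f u

/-- The pullback of a form to a normed space, expressed through a chart. -/
theorem coordPullback_eventuallyEq_chartRep [IsManifold 𝓘(ℝ, E) ∞ M] (Ω : DiffForm E M n)
    {f : W → M} {w : W}
    (hf : ∀ᶠ w' in 𝓝 w, ContMDiffAt 𝓘(ℝ, W) 𝓘(ℝ, E) ∞ f w') :
    ∀ᶠ w' in 𝓝 w, Ω.coordPullback f w' =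
      (Ω.chartRep (f w) (extChartAt 𝓘(ℝ, E) (f w) (f w'))).compContinuousLinearMap
        (fderiv ℝ (fun u => extChartAt 𝓘(ℝ, E) (f w) (f u)) w') := by
  have hn : (∞ : ℕ∞ω) ≠ 0 := by simp
  have h1 : ∀ᶠ w' in 𝓝 w, f w' ∈ (extChartAt 𝓘(ℝ, E) (f w)).source :=
    hf.self_of_nhds.continuousAt ((isOpen_extChartAt_source (f w)).mem_nhds
      (mem_extChartAt_source (f w)))
  filter_upwards [hf, h1, h1.eventually_nhds] with w' hw' h1' h1''
  have h2 : f =ᶠ[𝓝 w'] (extChartAt 𝓘(ℝ, E) (f w)).symm ∘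
      fun u => extChartAt 𝓘(ℝ, E) (f w) (f u) := by
    filter_upwards [h1''] with u hu
    exact ((extChartAt 𝓘(ℝ, E) (f w)).left_inv hu).symm
  have h3 := contMDiffAt_extChartAt_symm (f w) ((extChartAt 𝓘(ℝ, E) (f w)).map_source h1')
  have h4 : ContMDiffAt 𝓘(ℝ, W) 𝓘(ℝ, E) ∞ (fun u => extChartAt 𝓘(ℝ, E) (f w) (f u)) w' :=
    (contMDiffAt_extChartAt' (by simpa using h1')).comp w' hw'
  refine (Ω.pullback_congr h2).trans ((Ω.pullback_comp_apply (F := E)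
    (g := fun u => extChartAt 𝓘(ℝ, E) (f w) (f u)) (h3.mdifferentiableAt hn)
    (h4.mdifferentiableAt hn)).trans ?_)
  rw [← mfderiv_eq_fderiv]
  rfl

theorem contDiffAt_chart_comp [IsManifold 𝓘(ℝ, E) ∞ M] {f : W → M} {w : W}
    (hf : ContMDiffAt 𝓘(ℝ, W) 𝓘(ℝ, E) ∞ f w) :
    ContDiffAt ℝ ∞ (fun u => extChartAt 𝓘(ℝ, E) (f w) (f u)) w :=
  (ContMDiffAt.comp w (contMDiffAt_extChartAt' (by simp)) hf).contDiffAt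

theorem IsSmooth.contDiffAt_chartRep {Ω : DiffForm E M n} (hΩ : Ω.IsSmooth) (x : M) {y : E}
    (hy : y ∈ (extChartAt 𝓘(ℝ, E) x).target) : ContDiffAt ℝ ∞ (Ω.chartRep x) y :=
  (hΩ x).contDiffAt ((isOpen_extChartAt_target x).mem_nhds hy)

/-- Functoriality of pullback moves the question from `N` to a normed space, where only `Ω` and the
map `f ∘ φ⁻¹` remain. -/
theorem chartRep_eventuallyEq_pullback [IsManifold 𝓘(ℝ, F) ∞ N] {Ω : DiffForm E M n} {Θ : DiffForm F N n} {x : N} {y : F}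
    (hy : y ∈ (extChartAt 𝓘(ℝ, F) x).target) {f : N → M}
    (hf : ∀ᶠ q in 𝓝 ((extChartAt 𝓘(ℝ, F) x).symm y), ContMDiffAt 𝓘(ℝ, F) 𝓘(ℝ, E) ∞ f q ∧
      Θ q = Ω.pullback (F := F) f q) :
    (∀ᶠ u in 𝓝 y, ContMDiffAt 𝓘(ℝ, F) 𝓘(ℝ, E) ∞ (f ∘ (extChartAt 𝓘(ℝ, F) x).symm) u) ∧
    Θ.chartRep x =ᶠ[𝓝 y]
      Ω.coordPullback (f ∘ (extChartAt 𝓘(ℝ, F) x).symm) := by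
  have hn : (∞ : ℕ∞ω) ≠ 0 := by simp
  have h1 := (contMDiffAt_extChartAt_symm x hy).continuousAt.eventually hf
  have h2 := (isOpen_extChartAt_target (I := 𝓘(ℝ, F)) x).mem_nhds hy
  constructor
  · filter_upwards [h1, h2] with u hu hu'
    exact hu.1.comp u (contMDiffAt_extChartAt_symm x hu')
  · filter_upwards [h1, h2] with u hu hu'
    refine Eq.trans ?_ (Ω.pullback_comp_apply (F := F) (hu.1.mdifferentiableAt hn)
      ((contMDiffAt_extChartAt_symm x hu').mdifferentiableAt hn)).symm
    exact pullback_eq_of_eq (M := N) (N := F) Θ (Ω.pullback (F := F) f) hu.2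

variable [IsManifold 𝓘(ℝ, E) ∞ M]

theorem IsSmooth.contDiffAt_coordPullback {Ω : DiffForm E M n} (hΩ : Ω.IsSmooth) {f : W → M} {w : W}
    (hf : ∀ᶠ w' in 𝓝 w, ContMDiffAt 𝓘(ℝ, W) 𝓘(ℝ, E) ∞ f w') :
    ContDiffAt ℝ ∞ (Ω.coordPullback f) w := by
  refine ContDiffAt.congr_of_eventuallyEq ?_ (Ω.coordPullback_eventuallyEq_chartRep hf)
  have h := contDiffAt_chart_comp hf.self_of_nhds
  have h1 : ContDiffAt ℝ ∞
      (fun u => Ω.chartRep (f w) (extChartAt 𝓘(ℝ, E) (f w) (f u))) w :=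
    ContDiffAt.comp (g := Ω.chartRep (f w)) w
      (hΩ.contDiffAt_chartRep (f w) (mem_extChartAt_target (f w))) h
  exact h1.continuousAlternatingMapCompContinuousLinearMap
    (h.fderiv_right (m := ∞) (by simp))

/-- Through a chart of `M` the map goes between normed spaces, where `d` commutes with pullback, and
the chart expression of `Ω` is closed. -/
theorem IsClosed.extDeriv_coordPullback {Ω : DiffForm E M n} (hΩ : Ω.IsSmooth) (hc : Ω.IsClosed)
    {f : W → M} {w : W} (hf : ∀ᶠ w' in 𝓝 w, ContMDiffAt 𝓘(ℝ, W) 𝓘(ℝ, E) ∞ f w') :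
    extDeriv (Ω.coordPullback f) w = 0 := by
  rw [Filter.EventuallyEq.extDeriv_eq (Ω.coordPullback_eventuallyEq_chartRep hf)]
  have h := contDiffAt_chart_comp hf.self_of_nhds
  have h1 := hΩ.contDiffAt_chartRep (f w) (mem_extChartAt_target (f w))
  rw [extDeriv_pullback (r := ∞) (f := fun u => extChartAt 𝓘(ℝ, E) (f w) (f u)) (h1.differentiableAt (by simp)) h
      (by simpa using (ENat.LEInfty.out : (2 : ℕ∞ω) ≤ ∞)),
    hc (f w) _ (mem_extChartAt_target (f w))]
  ext v
  simp

variable [IsManifold 𝓘(ℝ, F) ∞ N]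

/-- A form which is locally a pullback of a smooth form is smooth. -/
theorem IsSmooth.of_locally_pullback {Ω : DiffForm E M n} (hΩ : Ω.IsSmooth) {Θ : DiffForm F N n}
    (h : ∀ q₀ : N, ∃ f : N → M, ∀ᶠ q in 𝓝 q₀, ContMDiffAt 𝓘(ℝ, F) 𝓘(ℝ, E) ∞ f q ∧
      Θ q = Ω.pullback (F := F) f q) : Θ.IsSmooth := by
  intro x y hy
  obtain ⟨f, hf⟩ := h ((extChartAt 𝓘(ℝ, F) x).symm y)
  obtain ⟨h1, h2⟩ := chartRep_eventuallyEq_pullback hy hf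
  exact ((hΩ.contDiffAt_coordPullback h1).congr_of_eventuallyEq h2).contDiffWithinAt

/-- A form which is locally a pullback of a smooth closed form is closed. -/
theorem IsClosed.of_locally_pullback {Ω : DiffForm E M n} (hΩ : Ω.IsSmooth) (hc : Ω.IsClosed)
    {Θ : DiffForm F N n}
    (h : ∀ q₀ : N, ∃ f : N → M, ∀ᶠ q in 𝓝 q₀, ContMDiffAt 𝓘(ℝ, F) 𝓘(ℝ, E) ∞ f q ∧
      Θ q = Ω.pullback (F := F) f q) : Θ.IsClosed := by
  intro x y hy
  obtain ⟨f, hf⟩ := h ((extChartAt 𝓘(ℝ, F) x).symm y)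
  obtain ⟨h1, h2⟩ := chartRep_eventuallyEq_pullback hy hf
  rw [Filter.EventuallyEq.extDeriv_eq h2]
  exact hc.extDeriv_coordPullback hΩ h1

end DiffForm

/-! ### Invariance of closed 1-forms that annihilate the orbits. -/

section Invariance

variable {E : Type*} [NormedAddCommGroup E] [NormedSpace ℝ E]
  {M : Type*} [TopologicalSpace M] [ChartedSpace E M]

theorem mfderiv_comp_apply_of_eventuallyEq
    {F : Type*} [NormedAddCommGroup F] [NormedSpace ℝ F]
    {N : Type*} [TopologicalSpace N] [ChartedSpace F N]
    {W : Type*} [NormedAddCommGroup W] [NormedSpace ℝ W]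
    {L : Type*} [TopologicalSpace L] [ChartedSpace W L]
    {f : N → M} {g : L → N} {h : L → M} {x : L} (hfg : h =ᶠ[𝓝 x] f ∘ g)
    (hf : MDifferentiableAt 𝓘(ℝ, F) 𝓘(ℝ, E) f (g x)) (hg : MDifferentiableAt 𝓘(ℝ, W) 𝓘(ℝ, F) g x)
    (v : TangentSpace 𝓘(ℝ, W) x) :
    (mfderiv 𝓘(ℝ, W) 𝓘(ℝ, E) h x v : E) =
      mfderiv 𝓘(ℝ, F) 𝓘(ℝ, E) f (g x) (mfderiv 𝓘(ℝ, W) 𝓘(ℝ, F) g x v) := by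
  have h1 := (hfg.mfderiv_eq (I := 𝓘(ℝ, W)) (I' := 𝓘(ℝ, E))).trans (mfderiv_comp x hf hg)
  exact DFunLike.congr_fun h1 v

theorem mfderiv_prodMk_left_apply {W V : Type*} [NormedAddCommGroup W] [NormedSpace ℝ W]
    [NormedAddCommGroup V] [NormedSpace ℝ V] {f : W × V → M} {u : W} {y : V}
    (hf : MDifferentiableAt 𝓘(ℝ, W × V) 𝓘(ℝ, E) f (u, y)) (w : W) :
    (mfderiv 𝓘(ℝ, W × V) 𝓘(ℝ, E) f (u, y) (w, (0 : V)) : E) =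
      mfderiv 𝓘(ℝ, W) 𝓘(ℝ, E) (fun s => f (s, y)) u w := by
  have h : HasMFDerivAt 𝓘(ℝ, W) 𝓘(ℝ, E) (f ∘ fun s => (s, y)) u _ :=
    HasMFDerivAt.comp u hf.hasMFDerivAt (hasFDerivAt_prodMk_left u y).hasMFDerivAt
  have h1 := h.mfderiv
  exact (DFunLike.congr_fun h1 w).symm

theorem mfderiv_prodMk_right_apply {W V : Type*} [NormedAddCommGroup W] [NormedSpace ℝ W]
    [NormedAddCommGroup V] [NormedSpace ℝ V] {f : W × V → M} {u : W} {y : V}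
    (hf : MDifferentiableAt 𝓘(ℝ, W × V) 𝓘(ℝ, E) f (u, y)) (v : V) :
    (mfderiv 𝓘(ℝ, W × V) 𝓘(ℝ, E) f (u, y) ((0 : W), v) : E) =
      mfderiv 𝓘(ℝ, V) 𝓘(ℝ, E) (fun s => f (u, s)) y v := by
  have h : HasMFDerivAt 𝓘(ℝ, V) 𝓘(ℝ, E) (f ∘ fun s => (u, s)) y _ :=
    HasMFDerivAt.comp y hf.hasMFDerivAt (hasFDerivAt_prodMk_right u y).hasMFDerivAt
  have h1 := h.mfderiv
  exact (DFunLike.congr_fun h1 v).symm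

variable {EG : Type*} [NormedAddCommGroup EG] [NormedSpace ℝ EG]
  {G : Type*} [TopologicalSpace G] [ChartedSpace EG G] [Group G]
  [MulAction G M] [ContMDiffSMul 𝓘(ℝ, EG) 𝓘(ℝ, E) ∞ G M]

variable (EG G) in
theorem contMDiff_smul_const (x : M) :
    ContMDiff 𝓘(ℝ, EG) 𝓘(ℝ, E) ∞ (fun g : G => g • x) :=
  contMDiff_id.smul contMDiff_const

variable [LieGroup 𝓘(ℝ, EG) ∞ G]

/-- Writing `h • x = (h g⁻¹) • (g • x)`, right translation carries `w` to the identity; the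
generator `ξ` is its image. -/
theorem mfderiv_smul_const_eq_infGen (g : G) (x : M) (w : TangentSpace 𝓘(ℝ, EG) g) :
    ∃ ξ : EG, (mfderiv 𝓘(ℝ, EG) 𝓘(ℝ, E) (fun h : G => h • x) g w : E) =
      infGen (E := E) G (g • x) ξ := by
  have hn : (∞ : ℕ∞ω) ≠ 0 := by simp
  have h1 : (fun h : G => h • x) = (fun h : G => h • g • x) ∘ fun h => h * g⁻¹ := by
    funext h
    simp [smul_smul]
  have h2 : MDifferentiableAt 𝓘(ℝ, EG) 𝓘(ℝ, EG) (fun h : G => h * g⁻¹) g :=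
    (contMDiff_mul_right (a := g⁻¹) (n := ∞)).mdifferentiable hn g
  have h3 := (contMDiff_smul_const (E := E) EG G (g • x)).mdifferentiable hn (g * g⁻¹)
  refine ⟨mfderiv 𝓘(ℝ, EG) 𝓘(ℝ, EG) (fun h : G => h * g⁻¹) g w, ?_⟩
  have h4 := mfderiv_comp_apply_of_eventuallyEq (Filter.EventuallyEq.of_eq h1) h3 h2 w
  refine h4.trans ?_
  unfold infGen
  rw [← mul_inv_cancel g]
  rfl

/-- A smooth closed `1`-form which annihilates the infinitesimal generators of an action of a
connected group is invariant. -/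
theorem DiffForm.IsClosed.pullback_smul [IsManifold 𝓘(ℝ, E) ∞ M] [ConnectedSpace G] {η : DiffForm E M 1}
    (hs : η.IsSmooth) (hc : η.IsClosed)
    (h0 : ∀ (ξ : EG) (x : M), η.covector x (infGen G x ξ) = 0) (g : G) :
    η.pullback (F := E) (fun x : M => g • x) = η := by
  have hn : (∞ : ℕ∞ω) ≠ 0 := by simp
  -- Local constancy suffices because `G` is connected and `Φ_1 = id`. It is Cartan's formula in
  -- coordinates: pull `η` back along the action map on a product of charts of `G` and `M`.
  have key : ∀ (x : M) (v : TangentSpace 𝓘(ℝ, E) x), IsLocallyConstant fun g : G =>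
      η.covector (g • x) (mfderiv 𝓘(ℝ, E) 𝓘(ℝ, E) (fun x : M => g • x) x v) := by
    intro x v
    rw [IsLocallyConstant.iff_eventually_eq]
    intro g₀
    set ψ := extChartAt 𝓘(ℝ, EG) g₀
    set φ := extChartAt 𝓘(ℝ, E) x
    let σ : EG × E → M := fun w => ψ.symm w.1 • φ.symm w.2
    let y₀ := φ x
    let v' : E := mfderiv 𝓘(ℝ, E) 𝓘(ℝ, E) φ x v
    let U : Set (EG × E) := ψ.target ×ˢ φ.target
    have hU : IsOpen U := (isOpen_extChartAt_target g₀).prod (isOpen_extChartAt_target x)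
    have hy₀ : y₀ ∈ φ.target := mem_extChartAt_target x
    have hφy : φ.symm y₀ = x := extChartAt_to_inv x
    have hσ : ∀ w ∈ U, ContMDiffAt 𝓘(ℝ, EG × E) 𝓘(ℝ, E) ∞ σ w := by
      rintro ⟨u, y⟩ ⟨hu, hy⟩
      have h1 : ContMDiffAt 𝓘(ℝ, EG × E) 𝓘(ℝ, EG) ∞ (fun w : EG × E => ψ.symm w.1) (u, y) :=
        (contMDiffAt_extChartAt_symm g₀ hu).comp (u, y) contDiff_fst.contMDiff.contMDiffAt
      have h2 : ContMDiffAt 𝓘(ℝ, EG × E) 𝓘(ℝ, E) ∞ (fun w : EG × E => φ.symm w.2) (u, y) :=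
        (contMDiffAt_extChartAt_symm x hy).comp (u, y) contDiff_snd.contMDiff.contMDiffAt
      exact h1.smul h2
    have hσ' : ∀ w ∈ U, ∀ᶠ w' in 𝓝 w, ContMDiffAt 𝓘(ℝ, EG × E) 𝓘(ℝ, E) ∞ σ w' := fun w hw =>
      Filter.eventually_of_mem (hU.mem_nhds hw) hσ
    let β := η.coordPullback σ
    have hβ1 : ∀ w ∈ U, ContDiffAt ℝ ∞ β w := fun w hw => hs.contDiffAt_coordPullback (hσ' w hw)
    have hβ2 : ∀ w ∈ U, extDeriv β w = 0 := fun w hw => hc.extDeriv_coordPullback hs (hσ' w hw)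
    have hβ : ∀ w z, β w ![z] = η.covector (σ w) (mfderiv 𝓘(ℝ, EG × E) 𝓘(ℝ, E) σ w z) :=
      fun w z =>
        (DiffForm.covector_eq (M := EG × E) (η.pullback (F := EG × E) σ) w z).symm.trans
          (DiffForm.pullback_covector (F := EG × E) η σ w z)
    -- Moving only the group variable moves along an orbit, where `η` vanishes.
    have hβ3 : ∀ w ∈ U, ∀ u', β w ![(u', (0 : E))] = 0 := by
      rintro ⟨u, y⟩ hw u'
      rw [hβ, mfderiv_prodMk_left_apply ((hσ _ hw).mdifferentiableAt hn)]
      have h2 : HasMFDerivAt 𝓘(ℝ, EG) 𝓘(ℝ, E) ((fun g : G => g • φ.symm y) ∘ ψ.symm) u _ :=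
        ((contMDiff_smul_const (E := E) EG G (φ.symm y)).mdifferentiable hn _).hasMFDerivAt.comp u
          ((contMDiffAt_extChartAt_symm g₀ hw.1).mdifferentiableAt hn).hasMFDerivAt
      obtain ⟨ξ, hξ⟩ := mfderiv_smul_const_eq_infGen (E := E) (ψ.symm u) (φ.symm y)
        (mfderiv 𝓘(ℝ, EG) 𝓘(ℝ, EG) ψ.symm u u')
      rw [show (mfderiv 𝓘(ℝ, EG) 𝓘(ℝ, E) (fun s => σ (s, y)) u u' : E) =
        infGen (E := E) G (ψ.symm u • φ.symm y) ξ from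
          (DFunLike.congr_fun h2.mfderiv u').trans hξ]
      exact h0 ξ _
    have hk : ∀ u ∈ ψ.target, β (u, y₀) ![((0 : EG), v')] =
        η.covector (ψ.symm u • x)
          (mfderiv 𝓘(ℝ, E) 𝓘(ℝ, E) (fun x : M => ψ.symm u • x) x v) := by
      intro u hu
      rw [hβ, mfderiv_prodMk_right_apply ((hσ (u, y₀) ⟨hu, hy₀⟩).mdifferentiableAt hn)]
      have h1 : (fun s => σ (u, s)) ∘ φ =ᶠ[𝓝 x] fun x : M => ψ.symm u • x := by
        filter_upwards [(isOpen_extChartAt_source (I := 𝓘(ℝ, E)) x).mem_nhds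
          (mem_extChartAt_source x)] with z hz
        simp only [σ, comp_apply]
        rw [φ.left_inv hz]
      have h2 : MDifferentiableAt 𝓘(ℝ, E) 𝓘(ℝ, E) (fun s => σ (u, s)) (φ x) :=
        ((hσ (u, y₀) ⟨hu, hy₀⟩).mdifferentiableAt hn).comp (I' := 𝓘(ℝ, EG × E)) (φ x)
          (hasFDerivAt_prodMk_right (𝕜 := ℝ) u (φ x)).hasMFDerivAt.mdifferentiableAt
      have h3 : MDifferentiableAt 𝓘(ℝ, E) 𝓘(ℝ, E) φ x :=
        (contMDiffAt_extChartAt (n := ∞)).mdifferentiableAt hn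
      have h5 := mfderiv_comp_apply_of_eventuallyEq h1.symm h2 h3 v
      have h6 : ∀ (z z' : M) (hz : z = z') (a a' : E) (ha : a = a'),
          η.covector z a = η.covector z' a' := by
        rintro z _ rfl a _ rfl; rfl
      exact h6 _ _ (by simp only [σ, hφy]) _ _ h5.symm
    have hd : ∀ u ∈ ψ.target,
        HasFDerivAt (fun u => β (u, y₀) ![((0 : EG), v')]) (0 : EG →L[ℝ] ℝ) u := by
      intro u hu
      have hw : (u, y₀) ∈ U := ⟨hu, hy₀⟩
      have hdβ := (hβ1 _ hw).differentiableAt hn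
      have h1 : HasFDerivAt ((fun w => β w ![((0 : EG), v')]) ∘ fun u => (u, y₀)) _ u :=
        HasFDerivAt.comp u
          (hdβ.continuousAlternatingMap_apply_const ![((0 : EG), v')]).hasFDerivAt
          (hasFDerivAt_prodMk_left u y₀)
      refine h1.congr_fderiv (ContinuousLinearMap.ext fun u' => ?_)
      -- On these constant fields `dβ = 0` equates the `u'`-derivative of `β(0, v')` with the
      -- `v'`-derivative of `β(u', 0)`, which is zero.
      have h2 := congrArg (fun f => f ![(u', (0 : E)), ((0 : EG), v')]) (hβ2 _ hw)
      simp only [extDeriv_apply hdβ] at h2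
      replace h2 := (Fin.sum_univ_two _).symm.trans h2
      have h3 : (fun w => β w ![(u', (0 : E))]) =ᶠ[𝓝 (u, y₀)] fun _ => 0 :=
        Filter.eventually_of_mem (hU.mem_nhds hw) fun w hw => hβ3 w hw u'
      have e1 : Fin.removeNth 1 ![(u', (0 : E)), ((0 : EG), v')] = ![(u', (0 : E))] := by
        funext i; fin_cases i; rfl
      have e0 : Fin.removeNth 0 ![(u', (0 : E)), ((0 : EG), v')] = ![((0 : EG), v')] := by
        funext i; fin_cases i; rfl
      rw [e0, e1, h3.fderiv_eq] at h2
      simpa using h2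
    obtain ⟨ε, hε, hball⟩ := Metric.isOpen_iff.1 (isOpen_extChartAt_target (I := 𝓘(ℝ, EG)) g₀)
      (ψ g₀) (mem_extChartAt_target g₀)
    have hconst : ∀ u ∈ Metric.ball (ψ g₀) ε,
        β (u, y₀) ![((0 : EG), v')] = β (ψ g₀, y₀) ![((0 : EG), v')] := fun u hu =>
      (convex_ball (ψ g₀) ε).is_const_of_fderivWithin_eq_zero (𝕜 := ℝ)
        (fun z hz => (hd z (hball hz)).differentiableAt.differentiableWithinAt)
        (fun z hz => by
          rw [fderivWithin_of_isOpen Metric.isOpen_ball hz, (hd z (hball hz)).fderiv])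
        hu (Metric.mem_ball_self hε)
    filter_upwards [(continuousAt_extChartAt (I := 𝓘(ℝ, EG)) g₀) (Metric.ball_mem_nhds _ hε),
      (isOpen_extChartAt_source (I := 𝓘(ℝ, EG)) g₀).mem_nhds (mem_extChartAt_source g₀)]
      with g hg hg'
    have := hconst _ hg
    rw [hk _ (hball hg), hk _ (mem_extChartAt_target g₀), ψ.left_inv hg',
      ψ.left_inv (mem_extChartAt_source g₀)] at this
    exact this
  funext x
  ext v
  have hv : v = ![v 0] := by
    funext i; fin_cases i; rfl
  rw [hv, ← DiffForm.covector_eq, ← DiffForm.covector_eq, DiffForm.pullback_covector,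
    (key x (v 0)).apply_eq_of_preconnectedSpace g 1]
  have h1 : (fun x : M => (1 : G) • x) = id := by
    funext x; simp
  have h6 : ∀ (z z' : M) (hz : z = z') (a a' : E) (ha : a = a'),
      η.covector z a = η.covector z' a' := by
    rintro z _ rfl a _ rfl; rfl
  refine h6 _ _ (one_smul G x) _ _ ?_
  rw [h1, mfderiv_id]
  rfl

end Invariance

/-! ### Velocities of curves in orbits and in regular level sets. -/

section TangentSpaces

/-- If a differentiable curve factors, with a continuous factor, through a map with injective
derivative, then its velocity lies in the range of that derivative. -/
theorem HasDerivAt.mem_range_of_comp_eq {V E : Type*} [NormedAddCommGroup V] [NormedSpace ℝ V]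
    [FiniteDimensional ℝ V] [NormedAddCommGroup E] [NormedSpace ℝ E] [FiniteDimensional ℝ E]
    {o : V → E} {A : V →L[ℝ] E} {γ : ℝ → V} {c : ℝ → E} {w : E}
    (ho : HasFDerivAt o A (γ 0)) (hA : Injective A) (hγ : ContinuousAt γ 0)
    (hc : HasDerivAt c w 0) (h : ∀ᶠ t in 𝓝 0, c t = o (γ t)) : ∃ ξ, A ξ = w := by
  obtain ⟨B₀, hB₀⟩ := A.toLinearMap.exists_leftInverse_of_injective (LinearMap.ker_eq_bot.2 hA)
  let B : E →L[ℝ] V := LinearMap.toContinuousLinearMap B₀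
  have hB : ∀ ξ, B (A ξ) = ξ := fun ξ => LinearMap.congr_fun hB₀ ξ
  -- Differentiability of `γ` is not assumed. As `A` is bounded below, this little-o makes `γ t - γ
  -- 0` of size `O(c t - c 0) = O(t)`, so `A (γ t - γ 0)` also has derivative `w`. Applying `A ∘ B`,
  -- which fixes the range of `A`, then gives `A (B w) = w`.
  have h1 : (fun t => c t - c 0 - A (γ t - γ 0)) =o[𝓝 0] fun t => γ t - γ 0 := by
    have := (hasFDerivAt_iff_isLittleO.1 ho).comp_tendsto hγ
    refine this.congr' ?_ EventuallyEq.rfl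
    filter_upwards [h] with t ht
    simp only [comp_apply]
    rw [ht, h.self_of_nhds]
  have h2 : (fun t => γ t - γ 0) =O[𝓝 0] fun t => A (γ t - γ 0) := by
    have := B.isBigO_comp (fun t => A (γ t - γ 0)) (𝓝 (0 : ℝ))
    simpa only [hB] using this
  have h3 : (fun t => A (γ t - γ 0)) =O[𝓝 0] fun t => c t - c 0 :=
    Asymptotics.IsEquivalent.isBigO_symm (h1.trans_isBigO h2)
  have h4 : (fun t => c t - c 0 - A (γ t - γ 0)) =o[𝓝 0] fun t : ℝ => t - 0 :=
    h1.trans_isBigO ((h2.trans h3).trans hc.isBigO_sub)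
  have h5 : HasDerivAt (fun t => A (γ t - γ 0)) w 0 := by
    rw [hasDerivAt_iff_isLittleO] at hc ⊢
    refine (hc.sub h4).congr_left fun t => ?_
    simp only [sub_self, map_zero]
    abel
  have h6 : HasDerivAt (fun t => A (B (A (γ t - γ 0)))) (A (B w)) 0 :=
    A.hasFDerivAt.comp_hasDerivAt 0 (B.hasFDerivAt.comp_hasDerivAt 0 h5)
  simp only [hB] at h6
  exact ⟨B w, h6.unique h5⟩

variable {E : Type*} [NormedAddCommGroup E] [NormedSpace ℝ E]
  {M : Type*} [TopologicalSpace M] [ChartedSpace E M]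

theorem hasDerivAt_extChartAt_comp {c : ℝ → M} (hc : MDifferentiableAt 𝓘(ℝ, ℝ) 𝓘(ℝ, E) c 0) :
    HasDerivAt (fun t => extChartAt 𝓘(ℝ, E) (c 0) (c t))
      (mfderiv 𝓘(ℝ, ℝ) 𝓘(ℝ, E) c 0 (1 : ℝ) : E) 0 := by
  have h := hc.hasMFDerivAt.2
  simp only [writtenInExtChartAt, extChartAt_self_eq, modelWithCornersSelf_coe, range_id] at h
  exact HasFDerivAt.hasDerivAt (F := E) (HasFDerivWithinAt.hasFDerivAt h univ_mem)

variable [FiniteDimensional ℝ E]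

/-- For a proper and free action `(g, x) ↦ (g • x, x)` is a closed embedding, so convergence in an
orbit forces convergence of the group elements. -/
theorem tendsto_of_smul_tendsto {G M α : Type*} [TopologicalSpace G] [TopologicalSpace M] [Group G]
    [MulAction G M] [ProperSMul G M] [IsCancelSMul G M] {l : Filter α} {γ : α → G} {x : M} {g : G}
    (h : Tendsto (fun t => γ t • x) l (𝓝 (g • x))) : Tendsto γ l (𝓝 g) := by
  have hp := ProperSMul.isProperMap_smul_pair (G := G) (X := M)
  have he : Topology.IsClosedEmbedding (fun gx : G × M => (gx.1 • gx.2, gx.2)) := by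
    refine .of_continuous_injective_isClosedMap hp.continuous ?_ hp.isClosedMap
    rintro ⟨a, y⟩ ⟨b, z⟩ hab
    simp only [Prod.mk.injEq] at hab
    obtain ⟨h1, rfl⟩ := hab
    rw [IsCancelSMul.right_cancel a b y h1]
  have h2 : Tendsto (fun t => (γ t, x)) l (𝓝 (g, x)) := by
    rw [he.isEmbedding.tendsto_nhds_iff]
    exact h.prodMk_nhds tendsto_const_nhds
  exact (continuous_fst.tendsto _).comp h2

section Action

variable {EG : Type*} [NormedAddCommGroup EG] [NormedSpace ℝ EG] [FiniteDimensional ℝ EG]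
  {G : Type*} [TopologicalSpace G] [ChartedSpace EG G] [Group G]
  [MulAction G M] [ContMDiffSMul 𝓘(ℝ, EG) 𝓘(ℝ, E) ∞ G M] [IsCancelSMul G M] [ProperSMul G M]

/-- The velocity of a curve in an orbit of a free and proper action is vertical. -/
theorem mfderiv_mem_verticalSpace {x : M} (hx : Injective (infGen (E := E) (EG := EG) G x))
    {c : ℝ → M} (hc0 : c 0 = x) (hc : MDifferentiableAt 𝓘(ℝ, ℝ) 𝓘(ℝ, E) c 0)
    (hcG : ∀ᶠ t in 𝓝 0, ∃ g : G, c t = g • x) :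
    ∃ ξ : EG, (infGen (E := E) (EG := EG) G x ξ : E) =
      mfderiv 𝓘(ℝ, ℝ) 𝓘(ℝ, E) c 0 (1 : ℝ) := by
  subst hc0
  classical
  -- The group elements are merely chosen; the default `1` is irrelevant near `0`. Freeness forces
  -- `γ 0 = 1`, and properness makes `γ` continuous at `0`.
  let γ : ℝ → G := fun t => if h : ∃ g : G, c t = g • c 0 then h.choose else 1
  have hγ : ∀ᶠ t in 𝓝 0, c t = γ t • c 0 := by
    filter_upwards [hcG] with t ht
    simp only [γ, dif_pos ht]
    exact ht.choose_spec
  have hγ0 : γ 0 = 1 := by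
    refine IsCancelSMul.right_cancel _ _ (c 0) ?_
    rw [one_smul]
    exact hγ.self_of_nhds.symm
  have hγc : ContinuousAt γ 0 := by
    unfold ContinuousAt
    refine tendsto_of_smul_tendsto (x := c 0) ?_
    rw [← hγ.self_of_nhds]
    exact hc.continuousAt.tendsto.congr' hγ
  let A : EG →L[ℝ] E := infGen (E := E) (EG := EG) G (c 0)
  have ho : HasFDerivAt (fun y => extChartAt 𝓘(ℝ, E) (c 0)
      ((extChartAt 𝓘(ℝ, EG) (1 : G)).symm y • c 0)) A
      (extChartAt 𝓘(ℝ, EG) (1 : G) 1) := by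
    have h := ((contMDiff_smul_const (E := E) EG G (c 0)).mdifferentiable (by simp) 1).hasMFDerivAt.2
    simp only [writtenInExtChartAt, modelWithCornersSelf_coe, range_id, one_smul] at h
    exact HasFDerivWithinAt.hasFDerivAt h univ_mem
  refine HasDerivAt.mem_range_of_comp_eq (E := E) (A := A) (γ := fun t => extChartAt 𝓘(ℝ, EG) (1 : G) (γ t))
    (by simpa only [hγ0] using ho) hx ?_ (hasDerivAt_extChartAt_comp hc) ?_
  · refine ContinuousAt.comp (g := extChartAt 𝓘(ℝ, EG) (1 : G)) ?_ hγc
    rw [hγ0]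
    exact continuousAt_extChartAt _
  · have h1 : ∀ᶠ t in 𝓝 0, γ t ∈ (extChartAt 𝓘(ℝ, EG) (1 : G)).source := by
      refine hγc.eventually_mem ?_
      rw [hγ0]
      exact extChartAt_source_mem_nhds _
    filter_upwards [hγ, h1] with t ht ht'
    rw [(extChartAt 𝓘(ℝ, EG) (1 : G)).left_inv ht', ← ht]

end Action

/-- The tangent space of a regular level set contains the kernel of the differential. -/
theorem exists_mfderiv_val_eq [IsManifold 𝓘(ℝ, E) ∞ M]
    {F : Type*} [NormedAddCommGroup F] [NormedSpace ℝ F] [FiniteDimensional ℝ F]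
    {J : M → F} (hJ : ContMDiff 𝓘(ℝ, E) 𝓘(ℝ, F) ∞ J) {μ : F}
    {EP : Type*} [NormedAddCommGroup EP] [NormedSpace ℝ EP] [ChartedSpace EP {x : M // J x = μ}]
    (hj : Manifold.IsSmoothEmbedding 𝓘(ℝ, EP) 𝓘(ℝ, E) ∞ (Subtype.val : {x : M // J x = μ} → M))
    (p : {x : M // J x = μ}) (hp : Surjective (mfderiv 𝓘(ℝ, E) 𝓘(ℝ, F) J p.1))
    (v : TangentSpace 𝓘(ℝ, E) p.1) (hv : mfderiv 𝓘(ℝ, E) 𝓘(ℝ, F) J p.1 v = 0) :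
    ∃ u : TangentSpace 𝓘(ℝ, EP) p, mfderiv 𝓘(ℝ, EP) 𝓘(ℝ, E) Subtype.val p u = v := by
  classical
  have hn : (∞ : ℕ∞ω) ≠ 0 := by simp
  obtain ⟨r, hr1, hr2⟩ := (hj.isImmersion.isImmersionAt p).exists_retraction
  set φ := extChartAt 𝓘(ℝ, E) p.1
  have hφs := contMDiffAt_extChartAt_symm (E := E) p.1 (mem_extChartAt_target p.1)
  have hφ : ContMDiffAt 𝓘(ℝ, E) 𝓘(ℝ, E) ∞ φ p.1 := contMDiffAt_extChartAt
  have hφp : φ.symm (φ p.1) = p.1 := extChartAt_to_inv p.1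
  let f : E → F := J ∘ φ.symm
  have hf : ContDiffAt ℝ ∞ f (φ p.1) := ((hJ _).comp _ hφs).contDiffAt
  have hf' : HasStrictFDerivAt f (fderiv ℝ f (φ p.1)) (φ p.1) := hf.hasStrictFDerivAt hn
  have hfφ : ∀ w : TangentSpace 𝓘(ℝ, E) p.1,
      fderiv ℝ f (φ p.1) (mfderiv 𝓘(ℝ, E) 𝓘(ℝ, E) φ p.1 w) =
        mfderiv 𝓘(ℝ, E) 𝓘(ℝ, F) J p.1 w := by
    intro w
    have h1 : J =ᶠ[𝓝 p.1] f ∘ φ := by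
      filter_upwards [extChartAt_source_mem_nhds (I := 𝓘(ℝ, E)) p.1] with z hz
      simp only [f, comp_apply]
      rw [φ.left_inv hz]
    rw [← mfderiv_eq_fderiv]
    exact (mfderiv_comp_apply_of_eventuallyEq h1 (hf.differentiableAt hn).mdifferentiableAt
      (hφ.mdifferentiableAt hn) w).symm
  have hsurj : (fderiv ℝ f (φ p.1)).range = ⊤ := by
    rw [LinearMap.range_eq_top]
    intro z
    obtain ⟨w, hw⟩ := hp z
    exact ⟨_, (hfφ w).trans hw⟩
  let v' : (fderiv ℝ f (φ p.1)).ker := ⟨mfderiv 𝓘(ℝ, E) 𝓘(ℝ, E) φ p.1 v, (hfφ v).trans hv⟩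
  -- The implicit function bends the straight line `t • v'` in the kernel into the level set without
  -- changing its initial velocity.
  let g := hf'.implicitFunction f _ hsurj (f (φ p.1))
  have hg0 : g 0 = φ p.1 := hf'.implicitFunction_apply_image hsurj
  have hg : HasFDerivAt g (fderiv ℝ f (φ p.1)).ker.subtypeL 0 :=
    (hf'.to_implicitFunction hsurj).hasFDerivAt
  have hl : HasDerivAt (fun t : ℝ => t • v') v' 0 := by
    simpa using (hasDerivAt_id (0 : ℝ)).smul_const v'
  have hgl : HasDerivAt (fun t : ℝ => g (t • v')) (v' : E) 0 := by
    refine HasFDerivAt.comp_hasDerivAt (l := g) (l' := (fderiv ℝ f (φ p.1)).ker.subtypeL) 0 ?_ hl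
    simpa using hg
  have hgl0 : g ((0 : ℝ) • v') = φ p.1 := by rw [zero_smul, hg0]
  let c : ℝ → M := fun t => φ.symm (g (t • v'))
  have hc0 : c 0 = p.1 := by simp only [c]; rw [hgl0, hφp]
  have hφs' : MDifferentiableAt 𝓘(ℝ, E) 𝓘(ℝ, E) φ.symm (g ((0 : ℝ) • v')) := by
    rw [hgl0]; exact hφs.mdifferentiableAt hn
  have hc : MDifferentiableAt 𝓘(ℝ, ℝ) 𝓘(ℝ, E) c 0 :=
    MDifferentiableAt.comp (I' := 𝓘(ℝ, E)) (0 : ℝ) hφs' hgl.differentiableAt.mdifferentiableAt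
  have hcv : (mfderiv 𝓘(ℝ, ℝ) 𝓘(ℝ, E) c 0 (1 : ℝ) : E) = v := by
    refine (mfderiv_comp_apply_of_eventuallyEq (EventuallyEq.refl _ c) hφs'
      hgl.differentiableAt.mdifferentiableAt (1 : ℝ)).trans ?_
    have h1 : (mfderiv 𝓘(ℝ, ℝ) 𝓘(ℝ, E) (fun t : ℝ => g (t • v')) 0 (1 : ℝ) : E) = (v' : E) := by
      rw [mfderiv_eq_fderiv, hgl.hasFDerivAt.fderiv]
      exact one_smul ℝ (v' : E)
    have h2 : id =ᶠ[𝓝 p.1] φ.symm ∘ φ := by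
      filter_upwards [extChartAt_source_mem_nhds (I := 𝓘(ℝ, E)) p.1] with z hz
      exact (φ.left_inv hz).symm
    have h3 := mfderiv_comp_apply_of_eventuallyEq h2 (hφs.mdifferentiableAt hn)
      (hφ.mdifferentiableAt hn) v
    rw [mfderiv_id] at h3
    have h4 : ∀ (y y' z z' : E), y = y' → z = z' →
        (mfderiv 𝓘(ℝ, E) 𝓘(ℝ, E) φ.symm y z : E) = mfderiv 𝓘(ℝ, E) 𝓘(ℝ, E) φ.symm y' z' := by
      rintro y _ z _ rfl rfl; rfl
    exact (h4 _ _ _ _ hgl0 h1).trans h3.symm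
  have hcJ : ∀ᶠ t in 𝓝 0, J (c t) = μ := by
    have h1 : Tendsto (fun t : ℝ => (f (φ p.1), t • v')) (𝓝 0) (𝓝 (f (φ p.1), 0)) := by
      refine tendsto_const_nhds.prodMk_nhds ?_
      simpa using hl.continuousAt.tendsto
    filter_upwards [h1.eventually (hf'.map_implicitFunction_eq hsurj)] with t ht
    refine ht.trans ?_
    simp only [f, comp_apply]
    rw [hφp, p.2]
  -- This lift to the level set, with default `p`, is only known to be continuous at `0`. That
  -- suffices for `r` to invert the inclusion along it, and `r ∘ c` is then the differentiable lift.
  let c' : ℝ → {x : M // J x = μ} := fun t => if h : J (c t) = μ then ⟨c t, h⟩ else p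
  have hc' : ∀ᶠ t in 𝓝 0, (c' t).1 = c t := by
    filter_upwards [hcJ] with t ht
    simp only [c', dif_pos ht]
  have hc'0 : c' 0 = p := Subtype.ext (hc'.self_of_nhds.trans hc0)
  have hc'c : ContinuousAt c' 0 := by
    rw [hj.isEmbedding.isInducing.continuousAt_iff]
    exact hc.continuousAt.congr (hc'.mono fun t ht => ht.symm)
  have h1 : c =ᶠ[𝓝 0] Subtype.val ∘ r ∘ c := by
    rw [← hc'0] at hr2
    filter_upwards [hc', hc'c.eventually hr2] with t ht ht'
    simp only [comp_apply]
    rw [← ht, ht']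
  have hr : MDifferentiableAt 𝓘(ℝ, E) 𝓘(ℝ, EP) r (c 0) := by
    rw [hc0]; exact hr1.self_of_nhds.mdifferentiableAt hn
  have hrc : MDifferentiableAt 𝓘(ℝ, ℝ) 𝓘(ℝ, EP) (r ∘ c) 0 := hr.comp 0 hc
  have hrp : (r ∘ c) 0 = p := by
    simp only [comp_apply]
    rw [hc0, hr2.self_of_nhds]
  have h2 := mfderiv_comp_apply_of_eventuallyEq h1
    (hj.contMDiff.mdifferentiable hn ((r ∘ c) 0)) hrc (1 : ℝ)
  have h5 : ∀ (q q' : {x : M // J x = μ}) (z : EP), q = q' →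
      (mfderiv 𝓘(ℝ, EP) 𝓘(ℝ, E) Subtype.val q z : E) =
        mfderiv 𝓘(ℝ, EP) 𝓘(ℝ, E) Subtype.val q' z := by
    rintro q _ z rfl; rfl
  exact ⟨_, ((h5 _ _ _ hrp).symm.trans h2.symm).trans hcv⟩

end TangentSpaces

/-! ### Factoring smooth data through embeddings and descending it along submersions. -/

section Descent

variable {E : Type*} [NormedAddCommGroup E] [NormedSpace ℝ E]
  {M : Type*} [TopologicalSpace M] [ChartedSpace E M]
  {F : Type*} [NormedAddCommGroup F] [NormedSpace ℝ F]
  {N : Type*} [TopologicalSpace N] [ChartedSpace F N]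
  {W : Type*} [NormedAddCommGroup W] [NormedSpace ℝ W]
  {L : Type*} [TopologicalSpace L] [ChartedSpace W L]

/-- A map into an embedded submanifold is smooth if it is smooth as a map to the ambient space. -/
theorem Manifold.IsSmoothEmbedding.contMDiffAt_of_comp {j : N → M}
    (hj : Manifold.IsSmoothEmbedding 𝓘(ℝ, F) 𝓘(ℝ, E) ∞ j) {f : L → N} {x : L}
    (hf : ContMDiffAt 𝓘(ℝ, W) 𝓘(ℝ, E) ∞ (j ∘ f) x) : ContMDiffAt 𝓘(ℝ, W) 𝓘(ℝ, F) ∞ f x := by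
  obtain ⟨r, hr1, hr2⟩ := (hj.isImmersion.isImmersionAt (f x)).exists_retraction
  have hc : ContinuousAt f x := by
    rw [hj.isEmbedding.isInducing.continuousAt_iff]
    exact hf.continuousAt
  have h1 : ContMDiffAt 𝓘(ℝ, W) 𝓘(ℝ, F) ∞ (r ∘ j ∘ f) x := hr1.self_of_nhds.comp x hf
  exact h1.congr_of_eventuallyEq (hc.eventually hr2 |>.mono fun y hy => hy.symm)

theorem Manifold.IsSmoothEmbedding.mfderiv_injective {j : N → M}
    (hj : Manifold.IsSmoothEmbedding 𝓘(ℝ, F) 𝓘(ℝ, E) ∞ j) (p : N) :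
    Injective (mfderiv 𝓘(ℝ, F) 𝓘(ℝ, E) j p) := by
  obtain ⟨r, hr1, hr2⟩ := (hj.isImmersion.isImmersionAt p).exists_retraction
  have h : ∀ u : TangentSpace 𝓘(ℝ, F) p,
      (mfderiv 𝓘(ℝ, E) 𝓘(ℝ, F) r (j p) (mfderiv 𝓘(ℝ, F) 𝓘(ℝ, E) j p u) : F) = u := by
    intro u
    have h1 : id =ᶠ[𝓝 p] r ∘ j := hr2.mono fun q hq => hq.symm
    have := mfderiv_comp_apply_of_eventuallyEq h1
      (hr1.self_of_nhds.mdifferentiableAt (by simp)) (hj.contMDiff.mdifferentiable (by simp) p) u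
    rw [mfderiv_id] at this
    exact this.symm
  intro u v huv
  rw [← h u, ← h v, huv]

theorem Manifold.IsSubmersion.mfderiv_surjective {f : N → M}
    (hf : Manifold.IsSubmersion 𝓘(ℝ, F) 𝓘(ℝ, E) ∞ f) (p : N) :
    Surjective (mfderiv 𝓘(ℝ, F) 𝓘(ℝ, E) f p) := by
  obtain ⟨σ, hσp, hσ⟩ := (hf.isSubmersionAt p).exists_section
  intro w
  have h1 : id =ᶠ[𝓝 (f p)] f ∘ σ := hσ.mono fun q hq => hq.2.symm
  have := mfderiv_comp_apply_of_eventuallyEq h1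
    (hf.contMDiff.mdifferentiable (by simp) (σ (f p)))
    (hσ.self_of_nhds.1.mdifferentiableAt (by simp)) w
  rw [mfderiv_id, hσp] at this
  exact ⟨_, this.symm⟩

/-- The local version is needed because the retraction of an immersion is smooth only near one
point. -/
theorem ContMDiffAt.tangentMap_of_eventually [IsManifold 𝓘(ℝ, E) ∞ M] [IsManifold 𝓘(ℝ, F) ∞ N]
    {f : N → M} {v : TangentBundle 𝓘(ℝ, F) N}
    (hf : ∀ᶠ q in 𝓝 v.1, ContMDiffAt 𝓘(ℝ, F) 𝓘(ℝ, E) ∞ f q) :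
    ContMDiffAt 𝓘(ℝ, F).tangent 𝓘(ℝ, E).tangent ∞ (tangentMap 𝓘(ℝ, F) 𝓘(ℝ, E) f) v := by
  obtain ⟨U, hU, hUo, hvU⟩ := mem_nhds_iff.1 hf
  have h1 : ContMDiffOn 𝓘(ℝ, F) 𝓘(ℝ, E) ∞ f U := fun q hq => (hU hq).contMDiffWithinAt
  have h2 := h1.contMDiffOn_tangentMapWithin (m := ∞) (by simp) hUo.uniqueMDiffOn
  have h3 : IsOpen (Bundle.TotalSpace.proj ⁻¹' U : Set (TangentBundle 𝓘(ℝ, F) N)) :=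
    hUo.preimage (FiberBundle.continuous_proj F (TangentSpace 𝓘(ℝ, F)))
  refine ((h2 v hvU).contMDiffAt (h3.mem_nhds hvU)).congr_of_eventuallyEq ?_
  filter_upwards [h3.mem_nhds hvU] with w hw
  exact (tangentMapWithin_eq_tangentMap (hUo.uniqueMDiffWithinAt hw)
    ((hU hw).mdifferentiableAt (by simp))).symm

/-- Smooth functions descend along surjective submersions. -/
theorem Manifold.IsSubmersion.contMDiff_of_comp {π : N → M}
    (hπ : Manifold.IsSubmersion 𝓘(ℝ, F) 𝓘(ℝ, E) ∞ π) (hs : Surjective π) {h : M → L}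
    (hh : ContMDiff 𝓘(ℝ, F) 𝓘(ℝ, W) ∞ (h ∘ π)) : ContMDiff 𝓘(ℝ, E) 𝓘(ℝ, W) ∞ h := by
  intro q
  obtain ⟨p, rfl⟩ := hs q
  obtain ⟨σ, hσp, hσ⟩ := (hπ.isSubmersionAt p).exists_section
  have h1 : ContMDiffAt 𝓘(ℝ, E) 𝓘(ℝ, W) ∞ ((h ∘ π) ∘ σ) (π p) :=
    (hh _).comp (π p) hσ.self_of_nhds.1
  refine h1.congr_of_eventuallyEq (hσ.mono fun q hq => ?_)
  simp only [comp_apply]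
  rw [hq.2]

namespace DiffForm

variable {n : ℕ}

theorem pullback_id (Θ : DiffForm E M n) (x : M) : Θ.pullback (F := E) id x = Θ x := by
  unfold pullback
  rw [mfderiv_id]
  ext v
  rfl

theorem ext_of_pullback_eq {π : N → M} (hπ : Manifold.IsSubmersion 𝓘(ℝ, F) 𝓘(ℝ, E) ∞ π)
    (hs : Surjective π) {Θ Θ' : DiffForm E M n}
    (h : Θ.pullback (F := F) π = Θ'.pullback (F := F) π) : Θ = Θ' := by
  funext q
  obtain ⟨p, rfl⟩ := hs q
  ext v
  choose u hu using fun i => hπ.mfderiv_surjective p (v i)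
  have h1 := congrArg (fun f => f u) (congrFun h p)
  simp only [pullback, ContinuousAlternatingMap.compContinuousLinearMap_apply] at h1
  have h2 : v = mfderiv 𝓘(ℝ, F) 𝓘(ℝ, E) π p ∘ u := funext fun i => (hu i).symm
  rw [h2]
  exact h1

/-- A basic form descends along a surjective submersion. -/
theorem exists_pullback_eq {π : N → M} (hπ : Manifold.IsSubmersion 𝓘(ℝ, F) 𝓘(ℝ, E) ∞ π)
    [FiniteDimensional ℝ E]
    (hs : Surjective π) (α : DiffForm F N n)
    (hα : ∀ p p' : N, π p = π p' → ∀ (v : Fin n → TangentSpace 𝓘(ℝ, F) p)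
      (v' : Fin n → TangentSpace 𝓘(ℝ, F) p'),
      (∀ i, (mfderiv 𝓘(ℝ, F) 𝓘(ℝ, E) π p (v i) : E) = mfderiv 𝓘(ℝ, F) 𝓘(ℝ, E) π p' (v' i)) →
      α p v = α p' v') :
    ∃ Θ : DiffForm E M n, Θ.pullback (F := F) π = α := by
  -- An arbitrary point of each fibre and an arbitrary linear right inverse of `Tπ` define the form;
  -- `hα` says that neither choice matters. Smoothness is obtained separately from local sections.
  choose s hs using hs
  have hR : ∀ p : N, ∃ R : E →L[ℝ] F, ∀ w : E,
      (mfderiv 𝓘(ℝ, F) 𝓘(ℝ, E) π p (R w) : E) = w := by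
    intro p
    let D : F →L[ℝ] E := mfderiv 𝓘(ℝ, F) 𝓘(ℝ, E) π p
    obtain ⟨R, hR⟩ := D.toLinearMap.exists_rightInverse_of_surjective
      (LinearMap.range_eq_top.2 (hπ.mfderiv_surjective p))
    exact ⟨LinearMap.toContinuousLinearMap R, fun w => LinearMap.congr_fun hR w⟩
  choose R hR using hR
  refine ⟨fun q => (show F [⋀^Fin n]→L[ℝ] ℝ from α (s q)).compContinuousLinearMap (R (s q)), ?_⟩
  funext p
  ext v
  exact hα _ _ (hs _) _ _ fun i => hR _ _

/-- For a local section `σ` of `π`, `Θ = (π ∘ σ)^* Θ = σ^* j^* Ω`, so `f = j ∘ σ` works. -/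
theorem exists_local_pullback {π : N → M} (hπ : Manifold.IsSubmersion 𝓘(ℝ, F) 𝓘(ℝ, E) ∞ π)
    (hs : Surjective π) {j : N → L} (hj : ContMDiff 𝓘(ℝ, F) 𝓘(ℝ, W) ∞ j)
    {Ω : DiffForm W L n} {Θ : DiffForm E M n}
    (h : Θ.pullback (F := F) π = Ω.pullback (F := F) j) (q₀ : M) :
    ∃ f : M → L, ∀ᶠ q in 𝓝 q₀, ContMDiffAt 𝓘(ℝ, E) 𝓘(ℝ, W) ∞ f q ∧
      Θ q = Ω.pullback (F := E) f q := by
  have hn : (∞ : ℕ∞ω) ≠ 0 := by simp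
  obtain ⟨p, rfl⟩ := hs q₀
  obtain ⟨σ, hσp, hσ⟩ := (hπ.isSubmersionAt p).exists_section
  refine ⟨j ∘ σ, ?_⟩
  filter_upwards [hσ, hσ.eventually_nhds] with q hq hq'
  refine ⟨(hj _).comp q hq.1, ?_⟩
  have hσq := hq.1.mdifferentiableAt hn
  have h1 : π ∘ σ =ᶠ[𝓝 q] id := hq'.mono fun y hy => hy.2
  rw [Ω.pullback_comp_apply (F := F) (hj.mdifferentiable hn _) hσq, ← h,
    ← Θ.pullback_comp_apply (F := F) (hπ.contMDiff.mdifferentiable hn _) hσq,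
    Θ.pullback_congr h1, pullback_id]

end DiffForm

end Descent

/-! ### Pointwise algebra of 2-forms and Reeb vectors. -/

section PolycosymplecticAlgebra

variable {k : ℕ} {E : Type*} [NormedAddCommGroup E] [NormedSpace ℝ E]
  {M : Type*} [TopologicalSpace M] [ChartedSpace E M]

namespace DiffForm

theorem swap (Ω : DiffForm E M 2) (x : M) (v w : TangentSpace 𝓘(ℝ, E) x) :
    Ω x ![v, w] = -Ω x ![w, v] := by
  have h := (Ω x).toAlternatingMap.map_swap ![w, v] (i := 0) (j := 1) (by decide)
  have h1 : ![w, v] ∘ Equiv.swap (0 : Fin 2) 1 = ![v, w] := by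
    funext i; fin_cases i <;> simp
  rw [h1] at h
  exact h

theorem map_add_left (Ω : DiffForm E M 2) (x : M) (v v' w : TangentSpace 𝓘(ℝ, E) x) :
    Ω x ![v + v', w] = Ω x ![v, w] + Ω x ![v', w] :=
  (Ω x).toAlternatingMap.map_vecCons_add ![w] v v'

theorem map_add_right (Ω : DiffForm E M 2) (x : M) (v w w' : TangentSpace 𝓘(ℝ, E) x) :
    Ω x ![v, w + w'] = Ω x ![v, w] + Ω x ![v, w'] := by
  rw [swap, map_add_left, neg_add, ← swap, ← swap]

end DiffForm

theorem PolycosymplecticStructure.reeb_spec [FiniteDimensional ℝ E]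
    (S : PolycosymplecticStructure k E M) (x : M) :
    (∀ a b w, S.Ω b x ![S.reeb a x, w] = 0) ∧
      (∀ a b, (S.η b).covector x (S.reeb a x) = if a = b then 1 else 0) :=
  (S.existsUnique_reeb x).choose_spec.1

/-- A subspace spanned by a family dual to a family of functionals. -/
theorem finrank_span_of_dual {V : Type*} [AddCommGroup V] [Module ℝ V] {r : Fin k → V}
    {e : Fin k → V →ₗ[ℝ] ℝ} (h : ∀ a b, e b (r a) = if a = b then 1 else 0) :
    Module.finrank ℝ (Submodule.span ℝ (range r)) = k ∧
      Submodule.span ℝ (range r) ⊓ (⨅ a, LinearMap.ker (e a)) = ⊥ := by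
  have he : ∀ (c : Fin k → ℝ) b, e b (∑ a, c a • r a) = c b := by
    intro c b
    simp [h]
  constructor
  · have hl : LinearIndependent ℝ r := by
      rw [Fintype.linearIndependent_iff]
      intro c hc b
      rw [← he c b, hc, map_zero]
    rw [finrank_span_eq_card hl, Fintype.card_fin]
  · rw [eq_bot_iff]
    rintro v ⟨hv, hv'⟩
    obtain ⟨c, rfl⟩ := (Submodule.mem_span_range_iff_exists_fun ℝ).1 hv
    have h1 : ∀ b, c b = 0 := fun b => by
      rw [← he c b]
      exact (Submodule.mem_iInf _).1 hv' b
    simp [h1]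

end PolycosymplecticAlgebra

/-! ### Tangent spaces of `J⁻¹(μ)` and the fibres of `π_μ`. -/

section LevelSet

variable {k : ℕ} {E : Type*} [NormedAddCommGroup E] [NormedSpace ℝ E]
  {M : Type*} [TopologicalSpace M] [ChartedSpace E M]
  {S : PolycosymplecticStructure k E M}
  {EG : Type*} [NormedAddCommGroup EG] [NormedSpace ℝ EG]
  {G : Type*} [TopologicalSpace G] [ChartedSpace EG G] [Group G] [MulAction G M]
  {J : M → Fin k → EG →L[ℝ] ℝ} {μ : Fin k → EG →L[ℝ] ℝ}

namespace IsEquivariantMomentumMap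

theorem apply_infGen (hJ : IsEquivariantMomentumMap G S J) (a : Fin k) (ξ : EG) (x : M)
    (v : TangentSpace 𝓘(ℝ, E) x) :
    S.Ω a x ![infGen G x ξ, v] =
      (mfderiv 𝓘(ℝ, E) 𝓘(ℝ, Fin k → EG →L[ℝ] ℝ) J x v : Fin k → EG →L[ℝ] ℝ) a ξ := by
  rw [hJ.momentum]
  let ev : (Fin k → EG →L[ℝ] ℝ) →L[ℝ] ℝ :=
    (ContinuousLinearMap.apply ℝ ℝ ξ).comp (ContinuousLinearMap.proj a)
  have h := mfderiv_comp_apply_of_eventuallyEq (EventuallyEq.refl (𝓝 x) (ev ∘ J))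
    (ev.differentiableAt.mdifferentiableAt) (hJ.smooth.mdifferentiable (by simp) x) v
  rw [mfderiv_eq_fderiv, ev.fderiv] at h
  exact h

/-- The momentum identity turns pairing with generators into the components of `dJ`. Over a regular
value this identifies `𝔤̃^{cω}` with the tangent space of the level set. -/
theorem mem_orth_verticalSpace (hJ : IsEquivariantMomentumMap G S J) {x : M}
    {v : TangentSpace 𝓘(ℝ, E) x} :
    v ∈ S.orth x (verticalSpace (EG := EG) G x) ↔
      (mfderiv 𝓘(ℝ, E) 𝓘(ℝ, Fin k → EG →L[ℝ] ℝ) J x v : Fin k → EG →L[ℝ] ℝ) = 0 := by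
  constructor
  · intro hv
    funext a
    ext ξ
    rw [← hJ.apply_infGen, DiffForm.swap]
    exact neg_eq_zero.2 (hv a (infGen G x ξ) ⟨ξ, rfl⟩)
  · rintro hv a _ ⟨ξ, rfl⟩
    rw [DiffForm.swap, neg_eq_zero]
    refine (hJ.apply_infGen a ξ x v).trans ?_
    rw [hv]
    rfl

/-- If `ξ_M(x) = 0`, every value of `dJᵃ` kills `ξ`; by regularity these values exhaust `𝔤*`. At
least one component `a` is needed. -/
theorem infGen_injective (hJ : IsEquivariantMomentumMap G S J) (hμ : IsRegularValue (E := E) J μ)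
    (hk : k ≠ 0) {x : M} (hx : J x = μ) : Injective (infGen (E := E) (EG := EG) G x) := by
  rw [injective_iff_map_eq_zero]
  intro ξ hξ
  by_contra hne
  obtain ⟨l, hl⟩ := SeparatingDual.exists_ne_zero (R := ℝ) hne
  obtain ⟨v, hv⟩ := hμ x hx (fun _ => l)
  have a : Fin k := ⟨0, Nat.pos_of_ne_zero hk⟩
  refine hl ?_
  have h1 := hJ.apply_infGen a ξ x v
  rw [hv, hξ] at h1
  exact h1.symm.trans ((S.Ω a x).map_coord_zero 0 rfl)

/-- Reeb vectors are in the kernel of every 2-form, hence orthogonal to everything. -/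
theorem mfderiv_reeb [FiniteDimensional ℝ E] (hJ : IsEquivariantMomentumMap G S J) (a : Fin k) (x : M) :
    (mfderiv 𝓘(ℝ, E) 𝓘(ℝ, Fin k → EG →L[ℝ] ℝ) J x (S.reeb a x) : Fin k → EG →L[ℝ] ℝ) = 0 := by
  rw [← hJ.mem_orth_verticalSpace]
  exact fun b s _ => (S.reeb_spec x).1 a b s

end IsEquivariantMomentumMap

variable {EP : Type*} [NormedAddCommGroup EP] [NormedSpace ℝ EP]
  [ChartedSpace EP (LevelSet J μ)]

theorem mfderiv_comp_val (hJ : ContMDiff 𝓘(ℝ, E) 𝓘(ℝ, Fin k → EG →L[ℝ] ℝ) ∞ J)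
    (hj : Manifold.IsSmoothEmbedding 𝓘(ℝ, EP) 𝓘(ℝ, E) ∞ (Subtype.val : LevelSet J μ → M))
    (p : LevelSet J μ) (u : TangentSpace 𝓘(ℝ, EP) p) :
    (mfderiv 𝓘(ℝ, E) 𝓘(ℝ, Fin k → EG →L[ℝ] ℝ) J p.1
      (mfderiv 𝓘(ℝ, EP) 𝓘(ℝ, E) Subtype.val p u) : Fin k → EG →L[ℝ] ℝ) = 0 := by
  have h1 : (fun _ => μ) =ᶠ[𝓝 p] J ∘ Subtype.val := Eventually.of_forall fun q => q.2.symm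
  have h := mfderiv_comp_apply_of_eventuallyEq h1 (hJ.mdifferentiable (by simp) p.1)
    (hj.contMDiff.mdifferentiable (by simp) p) u
  rw [mfderiv_const] at h
  exact h.symm

variable [LieGroup 𝓘(ℝ, EG) ∞ G]

theorem reducedProj_eq_iff {p p' : LevelSet J μ} :
    reducedProj G J μ p = reducedProj G J μ p' ↔ ∃ g ∈ isotropyGroup G μ, p.1 = g • p'.1 := by
  constructor
  · intro h
    obtain ⟨g, hg⟩ := Quotient.exact h
    exact ⟨g.1, g.2, hg.symm⟩
  · rintro ⟨g, hg, h⟩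
    exact Quotient.sound (s := levelSetSetoid G J μ) ⟨⟨g, hg⟩, h.symm⟩

/-- The action of an element of the isotropy group on the level set. -/
def levelSetSMul (hJ : IsEquivariantMomentumMap G S J) {g : G} (hg : g ∈ isotropyGroup G μ)
    (p : LevelSet J μ) : LevelSet J μ :=
  ⟨g • p.1, by rw [hJ.equivariant, p.2]; exact hg⟩

theorem reducedProj_levelSetSMul (hJ : IsEquivariantMomentumMap G S J) {g : G}
    (hg : g ∈ isotropyGroup G μ) (p : LevelSet J μ) :
    reducedProj G J μ (levelSetSMul hJ hg p) = reducedProj G J μ p :=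
  reducedProj_eq_iff.2 ⟨g, hg, rfl⟩

variable [ContMDiffSMul 𝓘(ℝ, EG) 𝓘(ℝ, E) ∞ G M]
  {EQ : Type*} [NormedAddCommGroup EQ] [NormedSpace ℝ EQ]
  [ChartedSpace EQ (ReducedSpace G J μ)]

theorem mdifferentiable_levelSetSMul (hJ : IsEquivariantMomentumMap G S J)
    (hj : Manifold.IsSmoothEmbedding 𝓘(ℝ, EP) 𝓘(ℝ, E) ∞ (Subtype.val : LevelSet J μ → M)) {g : G}
    (hg : g ∈ isotropyGroup G μ) :
    MDifferentiable 𝓘(ℝ, EP) 𝓘(ℝ, EP) (levelSetSMul hJ hg) := fun p =>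
  (hj.contMDiffAt_of_comp (f := levelSetSMul hJ hg)
    (((ContMDiffSMul.contMDiff_const_smul (I := 𝓘(ℝ, EG)) (n := ∞) g).comp
      hj.contMDiff) p)).mdifferentiableAt (by simp)

theorem mfderiv_val_levelSetSMul (hJ : IsEquivariantMomentumMap G S J)
    (hj : Manifold.IsSmoothEmbedding 𝓘(ℝ, EP) 𝓘(ℝ, E) ∞ (Subtype.val : LevelSet J μ → M)) {g : G}
    (hg : g ∈ isotropyGroup G μ) (p : LevelSet J μ) (u : TangentSpace 𝓘(ℝ, EP) p) :
    (mfderiv 𝓘(ℝ, EP) 𝓘(ℝ, E) Subtype.val (levelSetSMul hJ hg p)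
      (mfderiv 𝓘(ℝ, EP) 𝓘(ℝ, EP) (levelSetSMul hJ hg) p u) : E) =
    mfderiv 𝓘(ℝ, E) 𝓘(ℝ, E) (fun x : M => g • x) p.1
      (mfderiv 𝓘(ℝ, EP) 𝓘(ℝ, E) Subtype.val p u) := by
  have hn : (∞ : ℕ∞ω) ≠ 0 := by simp
  exact (mfderiv_comp_apply_of_eventuallyEq (EventuallyEq.refl (𝓝 p) _)
    (hj.contMDiff.mdifferentiable hn _) (mdifferentiable_levelSetSMul hJ hj hg p) u).symm.trans
    (mfderiv_comp_apply_of_eventuallyEq (f := fun x : M => g • x) (g := Subtype.val)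
      (EventuallyEq.refl (𝓝 p) _)
      ((ContMDiffSMul.contMDiff_const_smul (I := 𝓘(ℝ, EG)) (n := ∞) g).mdifferentiable hn _)
      (hj.contMDiff.mdifferentiable hn _) u)

theorem mfderiv_reducedProj_levelSetSMul (hJ : IsEquivariantMomentumMap G S J)
    (hj : Manifold.IsSmoothEmbedding 𝓘(ℝ, EP) 𝓘(ℝ, E) ∞ (Subtype.val : LevelSet J μ → M))
    (hπ : Manifold.IsSubmersion 𝓘(ℝ, EP) 𝓘(ℝ, EQ) ∞ (reducedProj G J μ)) {g : G}
    (hg : g ∈ isotropyGroup G μ) (p : LevelSet J μ) (u : TangentSpace 𝓘(ℝ, EP) p) :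
    (mfderiv 𝓘(ℝ, EP) 𝓘(ℝ, EQ) (reducedProj G J μ) (levelSetSMul hJ hg p)
      (mfderiv 𝓘(ℝ, EP) 𝓘(ℝ, EP) (levelSetSMul hJ hg) p u) : EQ) =
    mfderiv 𝓘(ℝ, EP) 𝓘(ℝ, EQ) (reducedProj G J μ) p u :=
  (mfderiv_comp_apply_of_eventuallyEq
    (Eventually.of_forall fun q => (reducedProj_levelSetSMul hJ hg q).symm)
    (hπ.contMDiff.mdifferentiable (by simp) _) (mdifferentiable_levelSetSMul hJ hj hg p) u).symm

/-- Vectors tangent to the fibres of `π_μ` are vertical. -/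
theorem exists_infGen_eq_of_mfderiv_reducedProj_eq_zero [FiniteDimensional ℝ E]
    [FiniteDimensional ℝ EG] [IsCancelSMul G M] [ProperSMul G M]
    (hJ : IsEquivariantMomentumMap G S J) (hμ : IsRegularValue (E := E) J μ)
    (hj : Manifold.IsSmoothEmbedding 𝓘(ℝ, EP) 𝓘(ℝ, E) ∞ (Subtype.val : LevelSet J μ → M))
    (hπ : Manifold.IsSubmersion 𝓘(ℝ, EP) 𝓘(ℝ, EQ) ∞ (reducedProj G J μ))
    (p : LevelSet J μ) (u : TangentSpace 𝓘(ℝ, EP) p)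
    (hu : mfderiv 𝓘(ℝ, EP) 𝓘(ℝ, EQ) (reducedProj G J μ) p u = 0) :
    ∃ ξ : EG, infGen (E := E) G p.1 ξ = mfderiv 𝓘(ℝ, EP) 𝓘(ℝ, E) Subtype.val p u := by
  rcases eq_or_ne k 0 with rfl | hk
  -- For `k = 0` both intersections are empty, so the nondegeneracy axiom forces `T_x M = 0`.
  · have h := S.ker_inf_ker p.1
    simp only [iInf_of_empty, inf_idem] at h
    have h0 : ∀ v : TangentSpace 𝓘(ℝ, E) p.1, v = 0 := fun v => by
      rw [← Submodule.mem_bot ℝ, ← h]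
      trivial
    exact ⟨0, by rw [h0 (mfderiv 𝓘(ℝ, EP) 𝓘(ℝ, E) Subtype.val p u), map_zero]⟩
  -- A curve in the fibre of `π_μ` runs inside a `G`-orbit. Obtaining `ξ` in `𝔤` rather than `𝔤_μ`
  -- is enough, since all of `𝔤̃` pairs to zero with vectors tangent to the level set.
  · obtain ⟨c, hc0, hc, hcu, hcπ⟩ := (hπ.isSubmersionAt p).exists_curve u hu
    have hv : MDifferentiableAt 𝓘(ℝ, EP) 𝓘(ℝ, E) (Subtype.val : LevelSet J μ → M) (c 0) :=
      hj.contMDiff.mdifferentiable (by simp) _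
    obtain ⟨ξ, hξ⟩ := mfderiv_mem_verticalSpace (c := Subtype.val ∘ c)
      (hJ.infGen_injective hμ hk p.2) (by simp [hc0]) (hv.comp 0 hc)
      (hcπ.mono fun t ht => by
        obtain ⟨g, -, hg⟩ := reducedProj_eq_iff.1 ht
        exact ⟨g, hg⟩)
    refine ⟨ξ, hξ.trans ?_⟩
    have h5 : ∀ (q q' : LevelSet J μ) (z z' : EP), q = q' → z = z' →
        (mfderiv 𝓘(ℝ, EP) 𝓘(ℝ, E) Subtype.val q z : E) =
          mfderiv 𝓘(ℝ, EP) 𝓘(ℝ, E) Subtype.val q' z' := by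
      rintro q _ z _ rfl rfl; rfl
    exact (mfderiv_comp_apply_of_eventuallyEq (EventuallyEq.refl _ _) hv hc (1 : ℝ)).trans
      (h5 _ _ _ _ hc0 hcu)

/-- The `G_μ`-orbit directions are tangent to the level set and killed by the projection. -/
theorem exists_of_mem_isotropyVerticalSpace
    (hJ : IsEquivariantMomentumMap G S J)
    (hj : Manifold.IsSmoothEmbedding 𝓘(ℝ, EP) 𝓘(ℝ, E) ∞ (Subtype.val : LevelSet J μ → M))
    (hπ : Manifold.IsSubmersion 𝓘(ℝ, EP) 𝓘(ℝ, EQ) ∞ (reducedProj G J μ))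
    (p : LevelSet J μ) {v : TangentSpace 𝓘(ℝ, E) p.1}
    (hv : v ∈ isotropyVerticalSpace G μ p.1) :
    ∃ u : TangentSpace 𝓘(ℝ, EP) p, mfderiv 𝓘(ℝ, EP) 𝓘(ℝ, E) Subtype.val p u = v ∧
      mfderiv 𝓘(ℝ, EP) 𝓘(ℝ, EQ) (reducedProj G J μ) p u = 0 := by
  have hn : (∞ : ℕ∞ω) ≠ 0 := by simp
  have key : isotropyVerticalSpace G μ p.1 ≤
      (LinearMap.ker (mfderiv 𝓘(ℝ, EP) 𝓘(ℝ, EQ) (reducedProj G J μ) p).toLinearMap).map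
        (mfderiv 𝓘(ℝ, EP) 𝓘(ℝ, E) (Subtype.val : LevelSet J μ → M) p).toLinearMap := by
    unfold isotropyVerticalSpace lieAlgebraOf
    rw [Submodule.map_le_iff_le_comap, Submodule.span_le]
    rintro ξ ⟨γ, hγ, hadd, hmem, rfl⟩
    have hγ0 : γ 0 = 1 := by
      have := hadd 0 0
      rw [add_zero] at this
      exact left_eq_mul.1 this
    -- By linearity only velocities of one-parameter subgroups of `G_μ` matter. Their orbit through
    -- `p` stays in the level set and projects to a point.
    let c : ℝ → LevelSet J μ := fun t => levelSetSMul hJ (hmem t) p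
    have hoγ : ContMDiff 𝓘(ℝ, ℝ) 𝓘(ℝ, E) ∞ ((fun g : G => g • p.1) ∘ γ) :=
      (contMDiff_smul_const (E := E) EG G p.1).comp hγ
    have hc : MDifferentiableAt 𝓘(ℝ, ℝ) 𝓘(ℝ, EP) c 0 :=
      (hj.contMDiffAt_of_comp (f := c) (hoγ 0)).mdifferentiableAt hn
    have hc0 : c 0 = p := Subtype.ext (by
      change γ 0 • p.1 = p.1
      rw [hγ0, one_smul])
    have h1 := mfderiv_comp_apply_of_eventuallyEq (EventuallyEq.refl (𝓝 (0 : ℝ)) (Subtype.val ∘ c))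
      (hj.contMDiff.mdifferentiable hn (c 0)) hc (1 : ℝ)
    have h2 := mfderiv_comp_apply_of_eventuallyEq
      (EventuallyEq.refl (𝓝 (0 : ℝ)) ((fun g : G => g • p.1) ∘ γ))
      ((contMDiff_smul_const (E := E) EG G p.1).mdifferentiable hn (γ 0)) (hγ.mdifferentiable hn 0) (1 : ℝ)
    have h3 := mfderiv_comp_apply_of_eventuallyEq (f := reducedProj G J μ) (g := c)
      (h := fun _ => reducedProj G J μ p)
      (Eventually.of_forall fun t => (reducedProj_levelSetSMul hJ (hmem t) p).symm)
      (hπ.contMDiff.mdifferentiable hn (c 0)) hc (1 : ℝ)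
    rw [mfderiv_const] at h3
    have h4 : ∀ (q q' : LevelSet J μ) (z : EP), q = q' →
        (mfderiv 𝓘(ℝ, EP) 𝓘(ℝ, E) Subtype.val q z : E) =
          mfderiv 𝓘(ℝ, EP) 𝓘(ℝ, E) Subtype.val q' z := by
      rintro q _ z rfl; rfl
    have h5 : ∀ (q q' : LevelSet J μ) (z : EP), q = q' →
        (mfderiv 𝓘(ℝ, EP) 𝓘(ℝ, EQ) (reducedProj G J μ) q z : EQ) =
          mfderiv 𝓘(ℝ, EP) 𝓘(ℝ, EQ) (reducedProj G J μ) q' z := by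
      rintro q _ z rfl; rfl
    have h6 : ∀ (g g' : G) (z : EG), g = g' →
        (mfderiv 𝓘(ℝ, EG) 𝓘(ℝ, E) (fun g : G => g • p.1) g z : E) =
          mfderiv 𝓘(ℝ, EG) 𝓘(ℝ, E) (fun g : G => g • p.1) g' z := by
      rintro q _ z rfl; rfl
    exact ⟨_, (h5 _ _ _ hc0).symm.trans h3.symm,
      (h4 _ _ _ hc0).symm.trans (h1.symm.trans (h2.trans (h6 _ _ _ hγ0)))⟩
  obtain ⟨u, hu, huv⟩ := key hv
  exact ⟨u, huv, hu⟩

end LevelSet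

/-! ### Restriction and projection of `k`-vector fields. -/

namespace KVectorField

variable {k : ℕ} {E : Type*} [NormedAddCommGroup E] [NormedSpace ℝ E]
  {M : Type*} [TopologicalSpace M] [ChartedSpace E M] [IsManifold 𝓘(ℝ, E) ∞ M]
  {F : Type*} [NormedAddCommGroup F] [NormedSpace ℝ F]
  {N : Type*} [TopologicalSpace N] [ChartedSpace F N] [IsManifold 𝓘(ℝ, F) ∞ N]

/-- A `k`-vector field tangent to an embedded submanifold restricts uniquely. -/
theorem existsUnique_restrict {j : N → M}
    (hj : Manifold.IsSmoothEmbedding 𝓘(ℝ, F) 𝓘(ℝ, E) ∞ j) (X : KVectorField k E M)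
    (hX : ∀ a p, X.toFun a (j p) ∈ range (mfderiv 𝓘(ℝ, F) 𝓘(ℝ, E) j p)) :
    ∃! Y : KVectorField k F N, Y.IsRelated j X := by
  choose u hu using hX
  refine ⟨⟨u, fun a p₀ => ?_⟩, hu, fun Y hY => ?_⟩
  -- Smoothness: near `p₀` the restriction is `Tr ∘ X ∘ j`.
  · obtain ⟨r, hr1, hr2⟩ := (hj.isImmersion.isImmersionAt p₀).exists_retraction
    have h1 : ContMDiffAt 𝓘(ℝ, F) 𝓘(ℝ, F).tangent ∞ (fun p => tangentMap 𝓘(ℝ, E) 𝓘(ℝ, F) r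
        (⟨j p, X.toFun a (j p)⟩ : TangentBundle 𝓘(ℝ, E) M)) p₀ :=
      (ContMDiffAt.tangentMap_of_eventually
        (v := (⟨j p₀, X.toFun a (j p₀)⟩ : TangentBundle 𝓘(ℝ, E) M)) hr1).comp p₀
        (((X.smooth a).comp hj.contMDiff) p₀)
    refine h1.congr_of_eventuallyEq ?_
    have hr1' := hj.contMDiff.continuous.continuousAt.eventually hr1
    filter_upwards [hr1', hr2.eventually_nhds] with p hp hp'
    have h2 := mfderiv_comp_apply_of_eventuallyEq (h := id)
      (hp'.mono fun q hq => hq.symm) (hp.mdifferentiableAt (by simp))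
      (hj.contMDiff.mdifferentiable (by simp) p) (u a p)
    rw [mfderiv_id, hu] at h2
    have h3 : ∀ (q q' : N) (v v' : F), q = q' → v = v' →
        (⟨q, v⟩ : TangentBundle 𝓘(ℝ, F) N) = ⟨q', v'⟩ := by
      rintro q _ v _ rfl rfl; rfl
    exact h3 _ _ _ _ hp'.self_of_nhds.symm h2
  · ext a p
    exact hj.mfderiv_injective p ((hY a p).trans (hu a p).symm)

/-- A projectable `k`-vector field projects uniquely along a surjective submersion. -/
theorem existsUnique_project {π : N → M}
    (hπ : Manifold.IsSubmersion 𝓘(ℝ, F) 𝓘(ℝ, E) ∞ π) (hs : Surjective π) (Y : KVectorField k F N)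
    (hY : ∀ a p p', π p = π p' → (mfderiv 𝓘(ℝ, F) 𝓘(ℝ, E) π p (Y.toFun a p) : E) =
      mfderiv 𝓘(ℝ, F) 𝓘(ℝ, E) π p' (Y.toFun a p')) :
    ∃! X : KVectorField k E M, Y.IsRelated π X := by
  obtain ⟨s, hs'⟩ := hs.hasRightInverse
  let X : Fin k → ∀ q : M, TangentSpace 𝓘(ℝ, E) q := fun a q =>
    (mfderiv 𝓘(ℝ, F) 𝓘(ℝ, E) π (s q) (Y.toFun a (s q)) : E)
  have hX : ∀ a p, (mfderiv 𝓘(ℝ, F) 𝓘(ℝ, E) π p (Y.toFun a p) : E) = X a (π p) := fun a p =>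
    hY a _ _ (hs' (π p)).symm
  refine ⟨⟨X, fun a q₀ => ?_⟩, hX, fun X' hX' => ?_⟩
  · obtain ⟨p₀, rfl⟩ := hs q₀
    -- The set-theoretic section `s` need not be continuous; by `hY` it can be replaced locally by a
    -- smooth `σ`, so the field is `Tπ ∘ Y ∘ σ`.
    obtain ⟨σ, hσp, hσ⟩ := (hπ.isSubmersionAt p₀).exists_section
    have h1 : ContMDiffAt 𝓘(ℝ, E) 𝓘(ℝ, E).tangent ∞ (fun q => tangentMap 𝓘(ℝ, F) 𝓘(ℝ, E) π
        (⟨σ q, Y.toFun a (σ q)⟩ : TangentBundle 𝓘(ℝ, F) N)) (π p₀) :=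
      ((hπ.contMDiff.contMDiff_tangentMap (m := ∞) (by simp)) _).comp (π p₀)
        (((Y.smooth a) _).comp (π p₀) hσ.self_of_nhds.1)
    refine h1.congr_of_eventuallyEq (hσ.mono fun q hq => ?_)
    have h3 : ∀ (x x' : M) (v v' : E), x = x' → v = v' →
        (⟨x, v⟩ : TangentBundle 𝓘(ℝ, E) M) = ⟨x', v'⟩ := by
      rintro x _ v _ rfl rfl; rfl
    exact h3 _ _ _ _ hq.2.symm (hY a _ _ ((hs' q).trans hq.2.symm))
  · ext a q
    obtain ⟨p, rfl⟩ := hs q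
    exact (hX' a p).symm.trans (hX a p)

end KVectorField

/-! ### The restricted forms are basic for `π_μ`. -/

section Reduction

variable {k : ℕ} {E : Type*} [NormedAddCommGroup E] [NormedSpace ℝ E] [FiniteDimensional ℝ E]
  {M : Type*} [TopologicalSpace M] [ChartedSpace E M]
  {S : PolycosymplecticStructure k E M}
  {EG : Type*} [NormedAddCommGroup EG] [NormedSpace ℝ EG] [FiniteDimensional ℝ EG]
  {G : Type*} [TopologicalSpace G] [ChartedSpace EG G] [Group G] [LieGroup 𝓘(ℝ, EG) ∞ G]
  [MulAction G M] [ContMDiffSMul 𝓘(ℝ, EG) 𝓘(ℝ, E) ∞ G M]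
  {J : M → Fin k → EG →L[ℝ] ℝ} {μ : Fin k → EG →L[ℝ] ℝ}
  {EP : Type*} [NormedAddCommGroup EP] [NormedSpace ℝ EP] [ChartedSpace EP (LevelSet J μ)]
  {EQ : Type*} [NormedAddCommGroup EQ] [NormedSpace ℝ EQ] [ChartedSpace EQ (ReducedSpace G J μ)]

theorem apply_infGen_mfderiv_val (hJ : IsEquivariantMomentumMap G S J)
    (hj : Manifold.IsSmoothEmbedding 𝓘(ℝ, EP) 𝓘(ℝ, E) ∞ (Subtype.val : LevelSet J μ → M))
    (a : Fin k) (ξ : EG) (p : LevelSet J μ) (u : TangentSpace 𝓘(ℝ, EP) p) :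
    S.Ω a p.1 ![infGen G p.1 ξ, mfderiv 𝓘(ℝ, EP) 𝓘(ℝ, E) Subtype.val p u] = 0 := by
  refine (hJ.apply_infGen a ξ p.1 _).trans ?_
  rw [mfderiv_comp_val hJ.smooth hj]
  rfl

variable [IsCancelSMul G M] [ProperSMul G M]

/-- Tangent vectors of `J⁻¹(μ)` with the same projection differ by the action and a vertical
vector. -/
theorem exists_mfderiv_val_eq_infGen_add (hJ : IsEquivariantMomentumMap G S J)
    (hμ : IsRegularValue (E := E) J μ)
    (hj : Manifold.IsSmoothEmbedding 𝓘(ℝ, EP) 𝓘(ℝ, E) ∞ (Subtype.val : LevelSet J μ → M))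
    (hπ : Manifold.IsSubmersion 𝓘(ℝ, EP) 𝓘(ℝ, EQ) ∞ (reducedProj G J μ)) {g : G}
    (hg : g ∈ isotropyGroup G μ) (p : LevelSet J μ)
    (u : TangentSpace 𝓘(ℝ, EP) (levelSetSMul hJ hg p)) (u' : TangentSpace 𝓘(ℝ, EP) p)
    (h : (mfderiv 𝓘(ℝ, EP) 𝓘(ℝ, EQ) (reducedProj G J μ) (levelSetSMul hJ hg p) u : EQ) =
      mfderiv 𝓘(ℝ, EP) 𝓘(ℝ, EQ) (reducedProj G J μ) p u') :
    ∃ ξ : EG, mfderiv 𝓘(ℝ, EP) 𝓘(ℝ, E) Subtype.val (levelSetSMul hJ hg p) u =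
      infGen (E := E) G (levelSetSMul hJ hg p).1 ξ +
        mfderiv 𝓘(ℝ, EP) 𝓘(ℝ, E) Subtype.val (levelSetSMul hJ hg p)
          (mfderiv 𝓘(ℝ, EP) 𝓘(ℝ, EP) (levelSetSMul hJ hg) p u') := by
  obtain ⟨ξ, hξ⟩ := exists_infGen_eq_of_mfderiv_reducedProj_eq_zero hJ hμ hj hπ
    (levelSetSMul hJ hg p) (u - mfderiv 𝓘(ℝ, EP) 𝓘(ℝ, EP) (levelSetSMul hJ hg) p u') (by
      rw [map_sub, sub_eq_zero]
      exact h.trans (mfderiv_reducedProj_levelSetSMul hJ hj hπ hg p u').symm)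
  refine ⟨ξ, ?_⟩
  rw [hξ, map_sub, sub_add_cancel]

/-- After translation by `g ∈ G_μ` the two tangent vectors differ from the given ones by generators,
which are orthogonal to vectors tangent to the level set. Invariance of `Ωᵃ` removes the
translation. -/
theorem pullback_Ω_basic (hG : IsPolycosymplecticAction EG G S)
    (hJ : IsEquivariantMomentumMap G S J) (hμ : IsRegularValue (E := E) J μ)
    (hj : Manifold.IsSmoothEmbedding 𝓘(ℝ, EP) 𝓘(ℝ, E) ∞ (Subtype.val : LevelSet J μ → M))
    (hπ : Manifold.IsSubmersion 𝓘(ℝ, EP) 𝓘(ℝ, EQ) ∞ (reducedProj G J μ)) (a : Fin k)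
    (p p' : LevelSet J μ) (hp : reducedProj G J μ p = reducedProj G J μ p')
    (v : Fin 2 → TangentSpace 𝓘(ℝ, EP) p) (v' : Fin 2 → TangentSpace 𝓘(ℝ, EP) p')
    (h : ∀ i, (mfderiv 𝓘(ℝ, EP) 𝓘(ℝ, EQ) (reducedProj G J μ) p (v i) : EQ) =
      mfderiv 𝓘(ℝ, EP) 𝓘(ℝ, EQ) (reducedProj G J μ) p' (v' i)) :
    (S.Ω a).pullback (F := EP) Subtype.val p v = (S.Ω a).pullback (F := EP) Subtype.val p' v' := by
  obtain ⟨g, hg, hgp⟩ := reducedProj_eq_iff.1 hp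
  obtain rfl : p = levelSetSMul hJ hg p' := Subtype.ext hgp
  obtain ⟨ξ₀, h₀⟩ := exists_mfderiv_val_eq_infGen_add hJ hμ hj hπ hg p' _ _ (h 0)
  obtain ⟨ξ₁, h₁⟩ := exists_mfderiv_val_eq_infGen_add hJ hμ hj hπ hg p' _ _ (h 1)
  have hv : v = ![v 0, v 1] := by funext i; fin_cases i <;> rfl
  have hv' : v' = ![v' 0, v' 1] := by funext i; fin_cases i <;> rfl
  rw [hv, hv', DiffForm.pullback_apply₂, DiffForm.pullback_apply₂, h₀, DiffForm.map_add_left,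
    apply_infGen_mfderiv_val hJ hj, zero_add, h₁, DiffForm.map_add_right, DiffForm.swap,
    apply_infGen_mfderiv_val hJ hj, neg_zero, zero_add]
  have h2 := DiffForm.pullback_apply₂ (F := E) (S.Ω a) (fun x : M => g • x) p'.1
    (mfderiv 𝓘(ℝ, EP) 𝓘(ℝ, E) Subtype.val p' (v' 0)) (mfderiv 𝓘(ℝ, EP) 𝓘(ℝ, E) Subtype.val p' (v' 1))
  rw [hG.pullback_Ω] at h2
  rw [h2]
  have h3 := fun i => mfderiv_val_levelSetSMul hJ hj hg p' (v' i)
  have h4 : ∀ A B A' B' : E, A = A' → B = B' →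
      (S.Ω a (g • p'.1) : E [⋀^Fin 2]→L[ℝ] ℝ) ![A, B] =
      (S.Ω a (g • p'.1) : E [⋀^Fin 2]→L[ℝ] ℝ) ![A', B'] := by
    rintro A B _ _ rfl rfl; rfl
  exact h4 _ _ _ _ (h3 0) (h3 1)

/-- The generator part dies by `contract_η`; the translation is removed by the invariance that
closedness and connectedness provide. -/
theorem pullback_η_basic [IsManifold 𝓘(ℝ, E) ∞ M] [ConnectedSpace G]
    (hG : IsPolycosymplecticAction EG G S)
    (hJ : IsEquivariantMomentumMap G S J) (hμ : IsRegularValue (E := E) J μ)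
    (hj : Manifold.IsSmoothEmbedding 𝓘(ℝ, EP) 𝓘(ℝ, E) ∞ (Subtype.val : LevelSet J μ → M))
    (hπ : Manifold.IsSubmersion 𝓘(ℝ, EP) 𝓘(ℝ, EQ) ∞ (reducedProj G J μ)) (a : Fin k)
    (p p' : LevelSet J μ) (hp : reducedProj G J μ p = reducedProj G J μ p')
    (v : Fin 1 → TangentSpace 𝓘(ℝ, EP) p) (v' : Fin 1 → TangentSpace 𝓘(ℝ, EP) p')
    (h : ∀ i, (mfderiv 𝓘(ℝ, EP) 𝓘(ℝ, EQ) (reducedProj G J μ) p (v i) : EQ) =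
      mfderiv 𝓘(ℝ, EP) 𝓘(ℝ, EQ) (reducedProj G J μ) p' (v' i)) :
    (S.η a).pullback (F := EP) Subtype.val p v = (S.η a).pullback (F := EP) Subtype.val p' v' := by
  obtain ⟨g, hg, hgp⟩ := reducedProj_eq_iff.1 hp
  obtain rfl : p = levelSetSMul hJ hg p' := Subtype.ext hgp
  obtain ⟨ξ, h₀⟩ := exists_mfderiv_val_eq_infGen_add hJ hμ hj hπ hg p' _ _ (h 0)
  have hv : v = ![v 0] := by funext i; fin_cases i; rfl
  have hv' : v' = ![v' 0] := by funext i; fin_cases i; rfl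
  rw [hv, hv', ← DiffForm.covector_eq, ← DiffForm.covector_eq, DiffForm.pullback_covector,
    DiffForm.pullback_covector, h₀, map_add, hG.contract_η, zero_add]
  have h2 := DiffForm.pullback_covector (F := E) (S.η a) (fun x : M => g • x) p'.1
    (mfderiv 𝓘(ℝ, EP) 𝓘(ℝ, E) Subtype.val p' (v' 0))
  rw [(S.closed_η a).pullback_smul (S.smooth_η a) (hG.contract_η a)] at h2
  rw [h2]
  have h3 := mfderiv_val_levelSetSMul hJ hj hg p' (v' 0)
  have h4 : ∀ A A' : E, A = A' → ((S.η a).covector (g • p'.1) : E →L[ℝ] ℝ) A =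
      ((S.η a).covector (g • p'.1) : E →L[ℝ] ℝ) A' := by
    rintro A _ rfl; rfl
  exact h4 _ _ h3

end Reduction

/-! ### Nondegeneracy of the reduced structure and the reduced dynamics. -/

section ReducedStructure

variable {k : ℕ} {E : Type*} [NormedAddCommGroup E] [NormedSpace ℝ E] [FiniteDimensional ℝ E]
  {M : Type*} [TopologicalSpace M] [ChartedSpace E M] [IsManifold 𝓘(ℝ, E) ∞ M]
  {S : PolycosymplecticStructure k E M}
  {EG : Type*} [NormedAddCommGroup EG] [NormedSpace ℝ EG] [FiniteDimensional ℝ EG]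
  {G : Type*} [TopologicalSpace G] [ChartedSpace EG G] [Group G] [LieGroup 𝓘(ℝ, EG) ∞ G]
  [MulAction G M] [ContMDiffSMul 𝓘(ℝ, EG) 𝓘(ℝ, E) ∞ G M]
  {J : M → Fin k → EG →L[ℝ] ℝ} {μ : Fin k → EG →L[ℝ] ℝ}
  {EP : Type*} [NormedAddCommGroup EP] [NormedSpace ℝ EP] [ChartedSpace EP (LevelSet J μ)]
  {EQ : Type*} [NormedAddCommGroup EQ] [NormedSpace ℝ EQ] [ChartedSpace EQ (ReducedSpace G J μ)]

theorem exists_mfderiv_val_eq_reeb (hJ : IsEquivariantMomentumMap G S J)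
    (hμ : IsRegularValue (E := E) J μ)
    (hj : Manifold.IsSmoothEmbedding 𝓘(ℝ, EP) 𝓘(ℝ, E) ∞ (Subtype.val : LevelSet J μ → M))
    (p : LevelSet J μ) (a : Fin k) :
    ∃ ρ : TangentSpace 𝓘(ℝ, EP) p,
      mfderiv 𝓘(ℝ, EP) 𝓘(ℝ, E) Subtype.val p ρ = S.reeb a p.1 :=
  exists_mfderiv_val_eq hJ.smooth hj p (hμ p.1 p.2) _ (hJ.mfderiv_reeb a p.1)

variable {Ω' : Fin k → DiffForm EQ (ReducedSpace G J μ) 2}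
  {η' : Fin k → DiffForm EQ (ReducedSpace G J μ) 1}

/-- The kernel of the reduced `2`-forms is spanned by the projections of the Reeb vectors. -/
theorem mem_span_of_reduced_apply_eq_zero (hJ : IsEquivariantMomentumMap G S J)
    (hμ : IsRegularValue (E := E) J μ)
    (hj : Manifold.IsSmoothEmbedding 𝓘(ℝ, EP) 𝓘(ℝ, E) ∞ (Subtype.val : LevelSet J μ → M))
    (hπ : Manifold.IsSubmersion 𝓘(ℝ, EP) 𝓘(ℝ, EQ) ∞ (reducedProj G J μ))
    (hΩ' : ∀ a, (Ω' a).pullback (F := EP) (reducedProj G J μ) =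
      (S.Ω a).pullback (F := EP) Subtype.val)
    {p : LevelSet J μ}
    (hred : S.orth p.1 (verticalSpace (EG := EG) G p.1) ⊓
        S.orth p.1 (S.orth p.1 (verticalSpace (EG := EG) G p.1)) ≤
      S.reebDist p.1 ⊔ isotropyVerticalSpace G μ p.1)
    {ρ : Fin k → TangentSpace 𝓘(ℝ, EP) p}
    (hρ : ∀ a, mfderiv 𝓘(ℝ, EP) 𝓘(ℝ, E) Subtype.val p (ρ a) = S.reeb a p.1)
    {w : TangentSpace 𝓘(ℝ, EQ) (reducedProj G J μ p)}
    (hw : ∀ a w', Ω' a (reducedProj G J μ p) ![w, w'] = 0) :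
    w ∈ Submodule.span ℝ
      (range fun a => mfderiv 𝓘(ℝ, EP) 𝓘(ℝ, EQ) (reducedProj G J μ) p (ρ a)) := by
  obtain ⟨u, rfl⟩ := hπ.mfderiv_surjective p w
  have h0 : mfderiv 𝓘(ℝ, EP) 𝓘(ℝ, E) Subtype.val p u ∈
      S.orth p.1 (verticalSpace (EG := EG) G p.1) :=
    hJ.mem_orth_verticalSpace.2 (mfderiv_comp_val hJ.smooth hj p u)
  have h1 : mfderiv 𝓘(ℝ, EP) 𝓘(ℝ, E) Subtype.val p u ∈
      S.orth p.1 (S.orth p.1 (verticalSpace (EG := EG) G p.1)) := by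
    -- A vector `s` orthogonal to the orbit is tangent to the level set, so its pairing with `Tj u`
    -- can be computed downstairs.
    intro a s hs
    obtain ⟨u₂, rfl⟩ := exists_mfderiv_val_eq hJ.smooth hj p (hμ p.1 p.2) s
      (hJ.mem_orth_verticalSpace.1 hs)
    refine (DiffForm.pullback_apply₂ (S.Ω a) Subtype.val p u u₂).symm.trans ?_
    rw [← hΩ', DiffForm.pullback_apply₂]
    exact hw a _
  obtain ⟨r, hr, i, hi, hri⟩ := Submodule.mem_sup.1 (hred ⟨h0, h1⟩)
  obtain ⟨c, rfl⟩ := (Submodule.mem_span_range_iff_exists_fun ℝ).1 hr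
  obtain ⟨u₃, rfl, hu₃⟩ := exists_of_mem_isotropyVerticalSpace hJ hj hπ p hi
  have h2 : u = ∑ a, c a • ρ a + u₃ := by
    apply hj.mfderiv_injective p
    rw [← hri, map_add, map_sum]
    simp only [map_smul, hρ]
  rw [h2, map_add, hu₃, add_zero, map_sum]
  refine Submodule.sum_mem _ fun a _ => ?_
  rw [map_smul]
  exact Submodule.smul_mem _ _ (Submodule.subset_span ⟨a, rfl⟩)

/-- No nondegeneracy of the reduced forms is assumed: the relations are used first to establish it,
and later to identify the Reeb vectors of the reduced structure. -/
theorem reduced_reeb_spec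
    (hπ : Manifold.IsSubmersion 𝓘(ℝ, EP) 𝓘(ℝ, EQ) ∞ (reducedProj G J μ))
    (hΩ' : ∀ a, (Ω' a).pullback (F := EP) (reducedProj G J μ) =
      (S.Ω a).pullback (F := EP) Subtype.val)
    (hη' : ∀ a, (η' a).pullback (F := EP) (reducedProj G J μ) =
      (S.η a).pullback (F := EP) Subtype.val)
    {p : LevelSet J μ} {ρ : Fin k → TangentSpace 𝓘(ℝ, EP) p}
    (hρ : ∀ a, mfderiv 𝓘(ℝ, EP) 𝓘(ℝ, E) Subtype.val p (ρ a) = S.reeb a p.1) :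
    (∀ a b w, Ω' b (reducedProj G J μ p)
      ![mfderiv 𝓘(ℝ, EP) 𝓘(ℝ, EQ) (reducedProj G J μ) p (ρ a), w] = 0) ∧
    (∀ a b, (η' b).covector (reducedProj G J μ p)
      (mfderiv 𝓘(ℝ, EP) 𝓘(ℝ, EQ) (reducedProj G J μ) p (ρ a)) = if a = b then 1 else 0) := by
  constructor
  · intro a b w
    obtain ⟨u, rfl⟩ := hπ.mfderiv_surjective p w
    rw [← DiffForm.pullback_apply₂, hΩ', DiffForm.pullback_apply₂, hρ]
    exact (S.reeb_spec p.1).1 a b _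
  · intro a b
    rw [← DiffForm.pullback_covector, hη', DiffForm.pullback_covector, hρ]
    exact (S.reeb_spec p.1).2 a b

/-- An invariant `k`-vector field restricted to the level set is projectable. -/
theorem mfderiv_reducedProj_eq_of_isRelated [IsManifold 𝓘(ℝ, EP) ∞ (LevelSet J μ)]
    (hJ : IsEquivariantMomentumMap G S J)
    (hj : Manifold.IsSmoothEmbedding 𝓘(ℝ, EP) 𝓘(ℝ, E) ∞ (Subtype.val : LevelSet J μ → M))
    (hπ : Manifold.IsSubmersion 𝓘(ℝ, EP) 𝓘(ℝ, EQ) ∞ (reducedProj G J μ))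
    {X : KVectorField k E M}
    (hXinv : ∀ g ∈ isotropyGroup G μ, ∀ a (x : M),
      mfderiv 𝓘(ℝ, E) 𝓘(ℝ, E) (fun y : M => g • y) x (X.toFun a x) = X.toFun a (g • x))
    {Xμ : KVectorField k EP (LevelSet J μ)} (hXμ : Xμ.IsRelated Subtype.val X) (a : Fin k)
    (p p' : LevelSet J μ) (hp : reducedProj G J μ p = reducedProj G J μ p') :
    (mfderiv 𝓘(ℝ, EP) 𝓘(ℝ, EQ) (reducedProj G J μ) p (Xμ.toFun a p) : EQ) =
      mfderiv 𝓘(ℝ, EP) 𝓘(ℝ, EQ) (reducedProj G J μ) p' (Xμ.toFun a p') := by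
  obtain ⟨g, hg, hgp⟩ := reducedProj_eq_iff.1 hp
  obtain rfl : p = levelSetSMul hJ hg p' := Subtype.ext hgp
  rw [← mfderiv_reducedProj_levelSetSMul hJ hj hπ hg p' (Xμ.toFun a p')]
  congr 1
  apply hj.mfderiv_injective
  refine (hXμ a _).trans (((hXinv g hg a p'.1).symm.trans ?_).trans
    (mfderiv_val_levelSetSMul hJ hj hg p' (Xμ.toFun a p')).symm)
  rw [hXμ]

variable [FiniteDimensional ℝ EQ] [IsManifold 𝓘(ℝ, EQ) ∞ (ReducedSpace G J μ)]

theorem solvesHamilton_reduced [IsManifold 𝓘(ℝ, EP) ∞ (LevelSet J μ)]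
    (hJ : IsEquivariantMomentumMap G S J) (hμ : IsRegularValue (E := E) J μ)
    (hj : Manifold.IsSmoothEmbedding 𝓘(ℝ, EP) 𝓘(ℝ, E) ∞ (Subtype.val : LevelSet J μ → M))
    (hπ : Manifold.IsSubmersion 𝓘(ℝ, EP) 𝓘(ℝ, EQ) ∞ (reducedProj G J μ))
    {H : M → ℝ} (hH : ContMDiff 𝓘(ℝ, E) 𝓘(ℝ, ℝ) ∞ H) {X : KVectorField k E M}
    (hX : S.SolvesHamilton X H) {S' : PolycosymplecticStructure k EQ (ReducedSpace G J μ)}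
    {h : ReducedSpace G J μ → ℝ} {Xμ : KVectorField k EP (LevelSet J μ)}
    {X' : KVectorField k EQ (ReducedSpace G J μ)}
    (hS' : IsReducedStructure EP S S' Subtype.val (reducedProj G J μ))
    (hh : ∀ p : LevelSet J μ, h (reducedProj G J μ p) = H p.1)
    (hXμ : Xμ.IsRelated Subtype.val X) (hX' : Xμ.IsRelated (reducedProj G J μ) X') :
    S'.SolvesHamilton X' h := by
  have hn : (∞ : ℕ∞ω) ≠ 0 := by simp
  have hs : Surjective (reducedProj G J μ) := Quotient.mk_surjective
  have hcomp : h ∘ reducedProj G J μ = H ∘ Subtype.val := funext hh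
  -- Smoothness of `h` follows from that of `H` on the level set, since `π_μ` is a surjective
  -- submersion.
  have hsm : ContMDiff 𝓘(ℝ, EQ) 𝓘(ℝ, ℝ) ∞ h :=
    hπ.contMDiff_of_comp hs (by rw [hcomp]; exact hH.comp hj.contMDiff)
  have hd : ∀ (p : LevelSet J μ) (u : TangentSpace 𝓘(ℝ, EP) p),
      dFun h (reducedProj G J μ p) (mfderiv 𝓘(ℝ, EP) 𝓘(ℝ, EQ) (reducedProj G J μ) p u) =
        dFun H p.1 (mfderiv 𝓘(ℝ, EP) 𝓘(ℝ, E) Subtype.val p u) := fun p u =>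
    (mfderiv_comp_apply_of_eventuallyEq (EventuallyEq.refl (𝓝 p) _) (hsm.mdifferentiable hn _)
      (hπ.contMDiff.mdifferentiable hn p) u).symm.trans
      (mfderiv_comp_apply_of_eventuallyEq (Eventually.of_forall (congrFun hcomp))
        (hH.mdifferentiable hn _) (hj.contMDiff.mdifferentiable hn p) u)
  choose ρ hρ using exists_mfderiv_val_eq_reeb hJ hμ hj
  have hreeb : ∀ p a, S'.reeb a (reducedProj G J μ p) =
      mfderiv 𝓘(ℝ, EP) 𝓘(ℝ, EQ) (reducedProj G J μ) p (ρ p a) := fun p a =>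
    congrFun ((S'.existsUnique_reeb _).unique (S'.reeb_spec _)
      (reduced_reeb_spec hπ hS'.pullback_Ω hS'.pullback_η (hρ p))) a
  have hη : ∀ a p (u : TangentSpace 𝓘(ℝ, EP) p), (S'.η a).covector (reducedProj G J μ p)
      (mfderiv 𝓘(ℝ, EP) 𝓘(ℝ, EQ) (reducedProj G J μ) p u) =
        (S.η a).covector p.1 (mfderiv 𝓘(ℝ, EP) 𝓘(ℝ, E) Subtype.val p u) := fun a p u => by
    rw [← DiffForm.pullback_covector, hS'.pullback_η, DiffForm.pullback_covector]
  constructor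
  · intro q a b
    obtain ⟨p, rfl⟩ := hs q
    rw [← hX', hη, hXμ]
    exact hX.1 p.1 a b
  · intro q w
    obtain ⟨p, rfl⟩ := hs q
    obtain ⟨u, rfl⟩ := hπ.mfderiv_surjective p w
    have h1 : ∀ a, S'.Ω a (reducedProj G J μ p) ![X'.toFun a (reducedProj G J μ p),
        mfderiv 𝓘(ℝ, EP) 𝓘(ℝ, EQ) (reducedProj G J μ) p u] =
        S.Ω a p.1 ![X.toFun a p.1, mfderiv 𝓘(ℝ, EP) 𝓘(ℝ, E) Subtype.val p u] := fun a => by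
      rw [← hX', ← DiffForm.pullback_apply₂, hS'.pullback_Ω, DiffForm.pullback_apply₂, hXμ]
    simp only [h1, hreeb, hd, hη, hρ]
    exact hX.2 p.1 _

variable [IsCancelSMul G M] [ProperSMul G M] [ConnectedSpace G]

theorem existsUnique_isReducedStructure (hG : IsPolycosymplecticAction EG G S)
    (hJ : IsEquivariantMomentumMap G S J) (hμ : IsRegularValue (E := E) J μ)
    (hj : Manifold.IsSmoothEmbedding 𝓘(ℝ, EP) 𝓘(ℝ, E) ∞ (Subtype.val : LevelSet J μ → M))
    (hπ : Manifold.IsSubmersion 𝓘(ℝ, EP) 𝓘(ℝ, EQ) ∞ (reducedProj G J μ))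
    (hred : ∀ x : M, J x = μ → S.orth x (verticalSpace (EG := EG) G x) ⊓
        S.orth x (S.orth x (verticalSpace (EG := EG) G x)) ≤
      S.reebDist x ⊔ isotropyVerticalSpace G μ x) :
    ∃! S' : PolycosymplecticStructure k EQ (ReducedSpace G J μ),
      IsReducedStructure EP S S' Subtype.val (reducedProj G J μ) := by
  have hs : Surjective (reducedProj G J μ) := Quotient.mk_surjective
  choose Ω' hΩ' using fun a => DiffForm.exists_pullback_eq hπ hs _
    (pullback_Ω_basic hG hJ hμ hj hπ a)
  choose η' hη' using fun a => DiffForm.exists_pullback_eq hπ hs _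
    (pullback_η_basic hG hJ hμ hj hπ a)
  choose ρ hρ using exists_mfderiv_val_eq_reeb hJ hμ hj
  have hspec := fun p => reduced_reeb_spec hπ hΩ' hη' (hρ p)
  have hker : ∀ p, (⨅ a, (Ω' a).ker₂ (reducedProj G J μ p)) = Submodule.span ℝ
      (range fun a => mfderiv 𝓘(ℝ, EP) 𝓘(ℝ, EQ) (reducedProj G J μ) p (ρ p a)) := fun p => by
    refine le_antisymm (fun w hw => ?_) (Submodule.span_le.2 ?_)
    · exact mem_span_of_reduced_apply_eq_zero hJ hμ hj hπ hΩ' (hred p.1 p.2) (hρ p)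
        fun a w' => (Submodule.mem_iInf _).1 hw a w'
    · rintro _ ⟨a, rfl⟩
      exact (Submodule.mem_iInf _).2 fun b w => (hspec p).1 a b w
  have hdual := fun p => finrank_span_of_dual
    (e := fun a => ((η' a).covector (reducedProj G J μ p)).toLinearMap) (hspec p).2
  refine ⟨⟨Ω', η', fun a => (S.smooth_Ω a).of_locally_pullback
      (DiffForm.exists_local_pullback hπ hs hj.contMDiff (hΩ' a)),
    fun a => (S.smooth_η a).of_locally_pullback
      (DiffForm.exists_local_pullback hπ hs hj.contMDiff (hη' a)),
    fun a => (S.closed_Ω a).of_locally_pullback (S.smooth_Ω a)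
      (DiffForm.exists_local_pullback hπ hs hj.contMDiff (hΩ' a)),
    fun a => (S.closed_η a).of_locally_pullback (S.smooth_η a)
      (DiffForm.exists_local_pullback hπ hs hj.contMDiff (hη' a)), ?_, ?_, ?_⟩, ⟨hΩ', hη'⟩, ?_⟩
  · intro q hq
    obtain ⟨p, rfl⟩ := hs q
    -- On the projected Reeb vectors the matrix of the reduced 1-forms is the identity, so the wedge
    -- takes the value `1`.
    have h1 := congrFun hq fun a => mfderiv 𝓘(ℝ, EP) 𝓘(ℝ, EQ) (reducedProj G J μ) p (ρ p a)
    have h2 : (Matrix.of fun a b => (η' a).covector (reducedProj G J μ p)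
        (mfderiv 𝓘(ℝ, EP) 𝓘(ℝ, EQ) (reducedProj G J μ) p (ρ p b))) = 1 := by
      ext a b
      rw [Matrix.of_apply, (hspec p).2, Matrix.one_apply]
      simp only [eq_comm]
    unfold DiffForm.wedge at h1
    rw [h2, Matrix.det_one] at h1
    exact one_ne_zero h1
  · intro q
    obtain ⟨p, rfl⟩ := hs q
    rw [hker]
    exact (hdual p).2
  · intro q
    obtain ⟨p, rfl⟩ := hs q
    rw [hker]
    exact (hdual p).1
  · rintro S' ⟨h1, h2⟩
    ext1
    · funext a
      exact DiffForm.ext_of_pullback_eq hπ hs ((h1 a).trans (hΩ' a).symm)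
    · funext a
      exact DiffForm.ext_of_pullback_eq hπ hs ((h2 a).trans (hη' a).symm)

end ReducedStructure

end

/-! ### The reduction theorem. -/

theorem mainTheorem6
    {k : ℕ}
    -- the phase space `M`
    {E : Type*} [NormedAddCommGroup E] [NormedSpace ℝ E] [FiniteDimensional ℝ E]
    {M : Type*} [TopologicalSpace M] [ChartedSpace E M] [IsManifold 𝓘(ℝ, E) ∞ M]
    [T2Space M] [SecondCountableTopology M]
    (S : PolycosymplecticStructure k E M)
    -- the connected Lie group `G`, acting smoothly, freely and properly
    {EG : Type*} [NormedAddCommGroup EG] [NormedSpace ℝ EG] [FiniteDimensional ℝ EG]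
    {G : Type*} [TopologicalSpace G] [ChartedSpace EG G] [Group G] [LieGroup 𝓘(ℝ, EG) ∞ G]
    [T2Space G] [SecondCountableTopology G] [ConnectedSpace G]
    [MulAction G M] [ContMDiffSMul 𝓘(ℝ, EG) 𝓘(ℝ, E) ∞ G M] [IsCancelSMul G M] [ProperSMul G M]
    (hG : IsPolycosymplecticAction EG G S)
    -- the momentum map and its regular value
    (J : M → Fin k → EG →L[ℝ] ℝ) (hJ : IsEquivariantMomentumMap G S J)
    (μ : Fin k → EG →L[ℝ] ℝ) (hμ : IsRegularValue (E := E) J μ)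
    -- `J⁻¹(μ)` with its structure of embedded submanifold of `M`
    {EP : Type*} [NormedAddCommGroup EP] [NormedSpace ℝ EP] [FiniteDimensional ℝ EP]
    [ChartedSpace EP (LevelSet J μ)] [IsManifold 𝓘(ℝ, EP) ∞ (LevelSet J μ)]
    (hj : Manifold.IsSmoothEmbedding 𝓘(ℝ, EP) 𝓘(ℝ, E) ∞ (Subtype.val : LevelSet J μ → M))
    -- `M_μ = J⁻¹(μ) / G_μ` with its quotient manifold structure
    {EQ : Type*} [NormedAddCommGroup EQ] [NormedSpace ℝ EQ] [FiniteDimensional ℝ EQ]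
    [ChartedSpace EQ (ReducedSpace G J μ)] [IsManifold 𝓘(ℝ, EQ) ∞ (ReducedSpace G J μ)]
    (hπ : Manifold.IsSubmersion 𝓘(ℝ, EP) 𝓘(ℝ, EQ) ∞ (reducedProj G J μ))
    -- the condition of the reduction theorem
    (hred : ∀ x : M, J x = μ →
      Disjoint (S.reebDist x) (isotropyVerticalSpace G μ x) ∧
      S.reebDist x ⊔ isotropyVerticalSpace G μ x =
        S.orth x (verticalSpace (EG := EG) G x) ⊓
          S.orth x (S.orth x (verticalSpace (EG := EG) G x)))
    -- the invariant Hamiltonian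
    (H : M → ℝ) (hH : ContMDiff 𝓘(ℝ, E) 𝓘(ℝ, ℝ) ∞ H) (hHG : ∀ (g : G) (x : M), H (g • x) = H x)
    -- the solution, tangent to `J⁻¹(μ)` and `G_μ`-invariant
    (X : KVectorField k E M) (hX : S.SolvesHamilton X H)
    (hXtan : ∀ a (p : LevelSet J μ), X.toFun a p.1 ∈
      Set.range (mfderiv 𝓘(ℝ, EP) 𝓘(ℝ, E) (Subtype.val : LevelSet J μ → M) p))
    (hXinv : ∀ g ∈ isotropyGroup G μ, ∀ a (x : M),
      mfderiv 𝓘(ℝ, E) 𝓘(ℝ, E) (fun y : M => g • y) x (X.toFun a x) = X.toFun a (g • x)) :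
    -- the reduced structure, Hamiltonian and `k`-vector fields `X_μ`, `X̄_μ` are well defined
    (∃! S' : PolycosymplecticStructure k EQ (ReducedSpace G J μ),
      IsReducedStructure EP S S' Subtype.val (reducedProj G J μ)) ∧
    (∃! h : ReducedSpace G J μ → ℝ, ContMDiff 𝓘(ℝ, EQ) 𝓘(ℝ, ℝ) ∞ h ∧
      ∀ p : LevelSet J μ, h (reducedProj G J μ p) = H p.1) ∧
    (∃! Xμ : KVectorField k EP (LevelSet J μ), Xμ.IsRelated Subtype.val X) ∧
    (∀ Xμ : KVectorField k EP (LevelSet J μ), Xμ.IsRelated Subtype.val X →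
      ∃! X' : KVectorField k EQ (ReducedSpace G J μ), Xμ.IsRelated (reducedProj G J μ) X') ∧
    -- and the reduced `k`-vector field solves the reduced equations
    ∀ (S' : PolycosymplecticStructure k EQ (ReducedSpace G J μ))
      (h : ReducedSpace G J μ → ℝ) (Xμ : KVectorField k EP (LevelSet J μ))
      (X' : KVectorField k EQ (ReducedSpace G J μ)),
      IsReducedStructure EP S S' Subtype.val (reducedProj G J μ) →
      (∀ p : LevelSet J μ, h (reducedProj G J μ p) = H p.1) →
      Xμ.IsRelated Subtype.val X → Xμ.IsRelated (reducedProj G J μ) X' →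
      S'.SolvesHamilton X' h := by
  have hs : Function.Surjective (reducedProj G J μ) := Quotient.mk_surjective
  refine ⟨existsUnique_isReducedStructure hG hJ hμ hj hπ fun x hx => (hred x hx).2.ge, ?_,
    X.existsUnique_restrict hj hXtan,
    fun Xμ hXμ => Xμ.existsUnique_project hπ hs
      (mfderiv_reducedProj_eq_of_isRelated hJ hj hπ hXinv hXμ),
    fun S' h Xμ X' hS' hh hXμ hX' =>
      solvesHamilton_reduced hJ hμ hj hπ hH hX hS' hh hXμ hX'⟩
  have hinv : ∀ p p' : LevelSet J μ, levelSetSetoid G J μ p p' → H p.1 = H p'.1 := by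
    intro p p' hp
    obtain ⟨g, -, hg⟩ := reducedProj_eq_iff.1 (Quotient.sound hp)
    rw [hg, hHG]
  refine ⟨Quotient.lift (fun p => H p.1) hinv, ⟨?_, fun p => rfl⟩, ?_⟩
  · exact hπ.contMDiff_of_comp hs (hH.comp hj.contMDiff)
  · rintro h ⟨-, hh⟩
    funext q
    obtain ⟨p, rfl⟩ := hs q
    exact hh p
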